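/- **Theorem 3.14.** Let $(B,g_B)$ and $(F,g_F)$ be (non-empty, Hausdorff, smooth, finite-dimensional) Riemannian manifolds of dimensions $n_1=\dim B\ge 2$ and $n_2=\dim F\ge 2$, let $f:B\to(0,\infty)$ be smooth, and let $M=B\times_f F$ be the warped product, i.e. the manifold $B\times F$ with the metric $g=g_B\oplus f^2g_F$ and Levi-Civita connection $\nabla$. Let $P$ be a smooth vector field on $F$ that is parallel for the Levi-Civita connection of $(F,g_F)$; denote its lift to $M$ again by $P$, put $\pi(Y)=g(Y,P)$, and let $$\overline\nabla_XY=\nabla_XY+\pi(Y)X$$ be the associated semi-symmetric connection on $M$. Let $\overline R(X,Y)Z=\overline\nabla_X\overline\nabla_YZ-\overline\nabla_Y\overline\nabla_XZ-\overline\nabla_{[X,Y]}Z$ be its curvature and $$\overline{Ric}(X,Y)=\sum_k g(\overline R(X,E_k)Y,E_k)\qquad((E_k)\ \text{a } g\text{-orthonormal basis})$$ its Ricci tensor. Suppose that $M$ is quasi-Einstein with respect to $\overline\nabla$ with generator tangent to $F$: there are real numbers $a,b$ and a smooth vector field $U$ on $M$ with $g(U,U)=1$, everywhere tangent to the fibres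 $\{p\}\times F$, such that $$\overline{Ric}(X,Y)=a\,g(X,Y)+b\,g(X,U)\,g(Y,U)\qquad\text{for all vector fields } X,Y \text{ on } M.$$ If $b\neq0$, then $f$ is constant. -/

import Mathlib

open scoped Manifold ContDiff Topology Pointwise

noncomputable section

/-! ### Riemannian metrics, Levi-Civita connection, curvature -/

section Connection

variable {E : Type*} [NormedAddCommGroup E] [NormedSpace ℝ E]
  {H : Type*} [TopologicalSpace H] {I : ModelWithCorners ℝ E H}
  {M : Type*} [TopologicalSpace M] [ChartedSpace H M] [IsManifold I ∞ M]

variable (I M) in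
/-- A smooth Riemannian metric on the manifold `M`. -/
abbrev SmoothMetric : Type _ :=
  Bundle.ContMDiffRiemannianMetric I ∞ E (fun x : M ↦ TangentSpace I x)

variable (I M) in
/-- A linear connection on `M`, that is, a covariant derivative on its tangent bundle.
Argument order: `nabla Y x (X x)` is the value of `∇_X Y` at `x`. -/
abbrev LinearConnection : Type _ :=
  CovariantDerivative I E (fun x : M ↦ TangentSpace I x)

/-- `nabla` is the Levi-Civita connection of `g`: it is smooth, torsion-free and metric. -/
structure IsLeviCivita [FiniteDimensional ℝ E] (g : SmoothMetric I M)
    (nabla : LinearConnection I M) : Prop where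
  smooth : CovariantDerivative.ContMDiffCovariantDerivative nabla ∞
  torsion_free : nabla.torsion = 0
  /-- `X g(Y, Z) = g(∇_X Y, Z) + g(Y, ∇_X Z)` for all vector fields `Y`, `Z` differentiable at `x`
  and all tangent vectors `X` at `x`. -/
  metric {Y Z : Π x : M, TangentSpace I x} {x : M} (hY : MDiffAt (T% Y) x) (hZ : MDiffAt (T% Z) x)
    (X : TangentSpace I x) :
    d% (fun y ↦ g.inner y (Y y) (Z y)) x X
      = g.inner x (nabla Y x X) (Z x) + g.inner x (Y x) (nabla Z x X)

/-- The connection `∇̄_X Y = ∇_X Y + π(Y) X`, where `π(Y) = g(Y, P)`. -/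
def semiSymmetricConnection (g : SmoothMetric I M) (nabla : LinearConnection I M)
    (P : Π x : M, TangentSpace I x) : LinearConnection I M :=
  nabla.addOneForm fun x ↦
    (g.inner x (P x)).smulRight (ContinuousLinearMap.id ℝ (TangentSpace I x))

theorem semiSymmetricConnection_apply (g : SmoothMetric I M) (nabla : LinearConnection I M)
    (P Y : Π x : M, TangentSpace I x) (x : M) (X : TangentSpace I x) :
    semiSymmetricConnection g nabla P Y x X = nabla Y x X + g.inner x (Y x) (P x) • X := by
  rw [g.symm]
  rfl

/-- The curvature `R(X, Y)Z = ∇_X ∇_Y Z - ∇_Y ∇_X Z - ∇_[X, Y] Z` of a linear connection. -/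
def curvature (nabla : LinearConnection I M) (X Y Z : Π x : M, TangentSpace I x) (x : M) :
    TangentSpace I x :=
  nabla (fun y ↦ nabla Z y (Y y)) x (X x) - nabla (fun y ↦ nabla Z y (X y)) x (Y x)
    - nabla Z x (VectorField.mlieBracket I X Y x)

/-- The value `R_x(u, v)w` of the curvature tensor on tangent vectors, computed by extending them
to vector fields that are smooth near `x`. -/
def curvatureAt (nabla : LinearConnection I M) (x : M) (u v w : TangentSpace I x) :
    TangentSpace I x :=
  curvature nabla (FiberBundle.extend E u) (FiberBundle.extend E v) (FiberBundle.extend E w) x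

open Bundle in
theorem exists_orthonormal_basis [FiniteDimensional ℝ E] (g : SmoothMetric I M) (x : M) :
    ∃ e : Module.Basis (Fin (Module.finrank ℝ E)) ℝ (TangentSpace I x),
      ∀ i j, g.inner x (e i) (e j) = if i = j then 1 else 0 := by
  let _ : RiemannianBundle (fun x : M ↦ TangentSpace I x) := ⟨g.toRiemannianMetric⟩
  have : FiniteDimensional ℝ (TangentSpace I x) := inferInstanceAs (FiniteDimensional ℝ E)
  let e := stdOrthonormalBasis ℝ (TangentSpace I x)
  have he (i j) : inner ℝ (e.toBasis i) (e.toBasis j) = if i = j then (1 : ℝ) else 0 := by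
    rw [e.coe_toBasis]
    exact orthonormal_iff_ite.1 e.orthonormal i j
  exact ⟨e.toBasis, he⟩

/-- A `g`-orthonormal basis of the tangent space at `x`. -/
def orthonormalBasisAt [FiniteDimensional ℝ E] (g : SmoothMetric I M) (x : M) :
    Module.Basis (Fin (Module.finrank ℝ E)) ℝ (TangentSpace I x) :=
  (exists_orthonormal_basis g x).choose

theorem orthonormalBasisAt_inner [FiniteDimensional ℝ E] (g : SmoothMetric I M) (x : M)
    (i j : Fin (Module.finrank ℝ E)) :
    g.inner x (orthonormalBasisAt g x i) (orthonormalBasisAt g x j) = if i = j then 1 else 0 :=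
  (exists_orthonormal_basis g x).choose_spec i j

/-- The Ricci tensor `Ric(v, w) = ∑ₖ g(R(v, eₖ)w, eₖ)` of a linear connection on `(M, g)`, where
`(eₖ)` is a `g`-orthonormal basis of the tangent space at `x`. -/
def ricci [FiniteDimensional ℝ E] (g : SmoothMetric I M) (nabla : LinearConnection I M) (x : M)
    (v w : TangentSpace I x) : ℝ :=
  ∑ k, g.inner x (curvatureAt nabla x v (orthonormalBasisAt g x k) w) (orthonormalBasisAt g x k)

/-- The Ricci tensor of the linear connection `nabla` on `(M, g)` has quasi-Einstein form with
real scalars `a`, `b` and generator `U`, a smooth `g`-unit vector field: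
`Ric(X, Y) = a g(X, Y) + b g(X, U) g(Y, U)`. -/
structure IsQuasiEinstein [FiniteDimensional ℝ E] (g : SmoothMetric I M)
    (nabla : LinearConnection I M) (a b : ℝ) (U : Π x : M, TangentSpace I x) : Prop where
  smooth : CMDiff ∞ (T% U)
  unit (x : M) : g.inner x (U x) (U x) = 1
  ricci_eq (x : M) (v w : TangentSpace I x) :
    ricci g nabla x v w = a * g.inner x v w + b * (g.inner x v (U x) * g.inner x w (U x))

end Connection

/-! ### Warped products -/

section Warped

variable {EB : Type*} [NormedAddCommGroup EB] [NormedSpace ℝ EB]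
  {HB : Type*} [TopologicalSpace HB] {IB : ModelWithCorners ℝ EB HB}
  {B : Type*} [TopologicalSpace B] [ChartedSpace HB B]
  {EF : Type*} [NormedAddCommGroup EF] [NormedSpace ℝ EF]
  {HF : Type*} [TopologicalSpace HF] {IF : ModelWithCorners ℝ EF HF}
  {F : Type*} [TopologicalSpace F] [ChartedSpace HF F]

/-- The component tangent to `B` of a tangent vector of `B × F`. -/
def toBase (z : B × F) : TangentSpace (IB.prod IF) z →L[ℝ] TangentSpace IB z.1 :=
  ContinuousLinearMap.fst ℝ EB EF

/-- The component tangent to `F` of a tangent vector of `B × F`. -/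
def toFiber (z : B × F) : TangentSpace (IB.prod IF) z →L[ℝ] TangentSpace IF z.2 :=
  ContinuousLinearMap.snd ℝ EB EF

/-- The inclusion of the tangent space of `F` at `z.2` into the tangent space of `B × F` at `z`. -/
def ofFiber (z : B × F) : TangentSpace IF z.2 →L[ℝ] TangentSpace (IB.prod IF) z :=
  ContinuousLinearMap.inr ℝ EB EF

theorem toBase_eq_mfderiv (z : B × F) :
    toBase (IB := IB) (IF := IF) z = mfderiv (IB.prod IF) IB Prod.fst z :=
  mfderiv_fst.symm

theorem toFiber_eq_mfderiv (z : B × F) :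
    toFiber (IB := IB) (IF := IF) z = mfderiv (IB.prod IF) IF Prod.snd z :=
  mfderiv_snd.symm

theorem ofFiber_eq_mfderiv (z : B × F) :
    ofFiber (IB := IB) (IF := IF) z = mfderiv IF (IB.prod IF) (fun q ↦ (z.1, q)) z.2 :=
  mfderiv_prod_right.symm

variable [IsManifold IB ∞ B] [IsManifold IF ∞ F]

/-- The bilinear form `g_B(v_B, w_B) + f² g_F(v_F, w_F)` on the tangent space of `B × F`. -/
def warpedInner (gB : SmoothMetric IB B) (gF : SmoothMetric IF F) (f : B → ℝ) (z : B × F) :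
    TangentSpace (IB.prod IF) z →L[ℝ] TangentSpace (IB.prod IF) z →L[ℝ] ℝ :=
  ((toBase z).precomp ℝ ∘L gB.inner z.1 ∘L toBase z)
    + (f z.1) ^ 2 • ((toFiber z).precomp ℝ ∘L gF.inner z.2 ∘L toFiber z)

theorem warpedInner_apply (gB : SmoothMetric IB B) (gF : SmoothMetric IF F) (f : B → ℝ)
    (z : B × F) (v w : TangentSpace (IB.prod IF) z) :
    warpedInner gB gF f z v w = gB.inner z.1 (toBase z v) (toBase z w)
      + (f z.1) ^ 2 * gF.inner z.2 (toFiber z v) (toFiber z w) :=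
  rfl

theorem SmoothMetric.inner_self_nonneg (g : SmoothMetric IB B) (x : B) (v : TangentSpace IB x) :
    0 ≤ g.inner x v v := by
  by_cases h : v = 0
  · simp [h]
  · exact (g.pos x v h).le

theorem warpedInner_pos (gB : SmoothMetric IB B) (gF : SmoothMetric IF F) (f : B → ℝ)
    (f_pos : ∀ p, 0 < f p) (z : B × F) (v : TangentSpace (IB.prod IF) z) (hv : v ≠ 0) :
    0 < warpedInner gB gF f z v v := by
  rw [warpedInner_apply]
  have h1 := gB.inner_self_nonneg z.1 (toBase z v)
  have h2 := mul_nonneg (sq_nonneg (f z.1)) (gF.inner_self_nonneg z.2 (toFiber z v))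
  by_cases hB : toBase z v = 0
  · have hF : toFiber z v ≠ 0 := fun hF ↦ hv (Prod.ext hB hF)
    have := mul_pos (pow_pos (f_pos z.1) 2) (gF.pos z.2 _ hF)
    linarith
  · have := gB.pos z.1 _ hB
    linarith

theorem warpedInner_isVonNBounded (gB : SmoothMetric IB B) (gF : SmoothMetric IF F) (f : B → ℝ)
    (f_pos : ∀ p, 0 < f p) (z : B × F) :
    Bornology.IsVonNBounded ℝ
      {v : TangentSpace (IB.prod IF) z | warpedInner gB gF f z v v < 1} := by
  have hB : Bornology.IsBounded {v : EB | gB.inner z.1 v v < 1} :=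
    NormedSpace.isVonNBounded_iff ℝ |>.1 (gB.isVonNBounded z.1)
  have hF : Bornology.IsBounded {v : EF | gF.inner z.2 v v < 1} :=
    NormedSpace.isVonNBounded_iff ℝ |>.1 (gF.isVonNBounded z.2)
  have hsub : {v : TangentSpace (IB.prod IF) z | warpedInner gB gF f z v v < 1} ⊆
      {v | gB.inner z.1 (toBase z v) (toBase z v) < 1 ∧
        gF.inner z.2 (f z.1 • toFiber z v) (f z.1 • toFiber z v) < 1} := by
    intro v hv
    have hv' : warpedInner gB gF f z v v < 1 := hv
    rw [warpedInner_apply] at hv'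
    have h1 := gB.inner_self_nonneg z.1 (toBase z v)
    have h2 := mul_nonneg (sq_nonneg (f z.1)) (gF.inner_self_nonneg z.2 (toFiber z v))
    refine ⟨by linarith, ?_⟩
    simp only [map_smul, _root_.smul_apply, smul_eq_mul]
    linarith
  refine Bornology.IsVonNBounded.subset hsub ?_
  have key : Bornology.IsVonNBounded ℝ
      ({v : EB | gB.inner z.1 v v < 1} ×ˢ ((f z.1)⁻¹ • {v : EF | gF.inner z.2 v v < 1})) :=
    (NormedSpace.isVonNBounded_iff ℝ).2 (hB.prod (hF.smul₀ ((f z.1)⁻¹)))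
  refine key.subset ?_
  rintro ⟨v, w⟩ ⟨hv, hw⟩
  exact ⟨hv, f z.1 • w, hw, inv_smul_smul₀ (f_pos z.1).ne' w⟩

theorem contMDiff_of_contMDiffAt_apply_symm {E : Type*} [NormedAddCommGroup E] [NormedSpace ℝ E]
    [FiniteDimensional ℝ E] {H : Type*} [TopologicalSpace H] {I : ModelWithCorners ℝ E H}
    {M : Type*} [TopologicalSpace M] [ChartedSpace H M] [IsManifold I ∞ M]
    (φ : Π x : M, TangentSpace I x →L[ℝ] TangentSpace I x →L[ℝ] ℝ)
    (h : ∀ (x₀ : M) (v w : E), CMDiffAt ∞ (fun x : M ↦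
      φ x ((trivializationAt E (TangentSpace I) x₀).symm x v)
        ((trivializationAt E (TangentSpace I) x₀).symm x w)) x₀) :
    ContMDiff I (I.prod 𝓘(ℝ, E →L[ℝ] E →L[ℝ] ℝ)) ∞
      (fun x ↦ Bundle.TotalSpace.mk' (E →L[ℝ] E →L[ℝ] ℝ)
        (E := fun x : M ↦ TangentSpace I x →L[ℝ] TangentSpace I x →L[ℝ] ℝ) x (φ x)) := by
  intro x₀
  rw [contMDiffAt_hom_bundle]
  refine ⟨contMDiffAt_id, ?_⟩
  let b := Module.finBasis ℝ E
  let c (i) : E →L[ℝ] ℝ := LinearMap.toContinuousLinearMap (b.coord i)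
  have hsum (A : E →L[ℝ] E →L[ℝ] ℝ) :
      A = ∑ i, ∑ j, A (b i) (b j) • (c i).smulRight (c j) := by
    ext v w
    conv_lhs => rw [← b.sum_repr v, ← b.sum_repr w]
    simp only [map_sum, _root_.sum_apply, map_smul, _root_.smul_apply, smul_eq_mul,
      ContinuousLinearMap.smulRight_apply, c, LinearMap.coe_toContinuousLinearMap',
      Module.Basis.coord_apply]
    rw [Finset.sum_comm]
    refine Finset.sum_congr rfl fun i _ ↦ ?_
    rw [Finset.mul_sum]
    refine Finset.sum_congr rfl fun j _ ↦ ?_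
    ring
  have key : CMDiffAt ∞ (fun x : M ↦ ∑ i, ∑ j,
      (φ x ((trivializationAt E (TangentSpace I) x₀).symm x (b i))
        ((trivializationAt E (TangentSpace I) x₀).symm x (b j))) • (c i).smulRight (c j)) x₀ := by
    refine ContMDiffAt.sum fun i _ ↦ ContMDiffAt.sum fun j _ ↦ ?_
    exact (h x₀ (b i) (b j)).smul contMDiffAt_const
  refine key.congr_of_eventuallyEq ?_
  have hmem := (trivializationAt E (TangentSpace I : M → Type _) x₀).open_baseSet.mem_nhds
    (FiberBundle.mem_baseSet_trivializationAt' x₀)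
  filter_upwards [hmem] with x hx
  rw [hsum (ContinuousLinearMap.inCoordinates E (fun x : M ↦ TangentSpace I x) (E →L[ℝ] ℝ)
    (fun x : M ↦ TangentSpace I x →L[ℝ] ℝ) x₀ x x₀ x (φ x))]
  refine Finset.sum_congr rfl fun i _ ↦ Finset.sum_congr rfl fun j _ ↦ ?_
  congr 1
  refine (inCoordinates_apply_eq₂ (𝕜 := ℝ) (F₁ := E) (E₁ := fun x : M ↦ TangentSpace I x) (F₂ := E)
    (E₂ := fun x : M ↦ TangentSpace I x) (F₃ := ℝ) (E₃ := Bundle.Trivial M ℝ)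
    (ϕ := φ x) hx hx (Set.mem_univ x)).trans ?_
  exact congrFun (Bundle.Trivialization.coe_linearMapAt_of_mem
    (trivializationAt ℝ (Bundle.Trivial M ℝ) x₀) (Set.mem_univ x)) _

theorem warpedInner_contMDiff [FiniteDimensional ℝ EB] [FiniteDimensional ℝ EF]
    (gB : SmoothMetric IB B) (gF : SmoothMetric IF F) (f : B → ℝ) (hf : CMDiff ∞ f) :
    ContMDiff (IB.prod IF) ((IB.prod IF).prod 𝓘(ℝ, EB × EF →L[ℝ] EB × EF →L[ℝ] ℝ)) ∞
      (fun z : B × F ↦ Bundle.TotalSpace.mk' (EB × EF →L[ℝ] EB × EF →L[ℝ] ℝ)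
        (E := fun z : B × F ↦ TangentSpace (IB.prod IF) z →L[ℝ] TangentSpace (IB.prod IF) z →L[ℝ] ℝ)
        z (warpedInner gB gF f z)) := by
  refine contMDiff_of_contMDiffAt_apply_symm _ fun z₀ v w ↦ ?_
  simp only [warpedInner_apply]
  let t := trivializationAt (EB × EF) (TangentSpace (IB.prod IF) : B × F → Type _) z₀
  have hz₀ : z₀ ∈ t.baseSet := FiberBundle.mem_baseSet_trivializationAt' z₀
  have hs (u : EB × EF) : CMDiffAt ∞ (fun z : B × F ↦ Bundle.TotalSpace.mk' (EB × EF)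
      (E := (TangentSpace (IB.prod IF) : B × F → Type _)) z (t.symm z u)) z₀ := by
    rw [Bundle.contMDiffAt_section]
    refine (contMDiffAt_const (c := u)).congr_of_eventuallyEq ?_
    filter_upwards [t.open_baseSet.mem_nhds hz₀] with z hz
    exact congrArg Prod.snd (t.apply_mk_symm hz u)
  have hsB (u : EB × EF) : CMDiffAt ∞ (fun z : B × F ↦ Bundle.TotalSpace.mk' EB
      (E := (TangentSpace IB : B → Type _)) z.1 (toBase z (t.symm z u))) z₀ :=
    (contMDiff_equivTangentBundleProd.contMDiffAt.comp z₀ (hs u)).fst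
  have hsF (u : EB × EF) : CMDiffAt ∞ (fun z : B × F ↦ Bundle.TotalSpace.mk' EF
      (E := (TangentSpace IF : F → Type _)) z.2 (toFiber z (t.symm z u))) z₀ :=
    (contMDiff_equivTangentBundleProd.contMDiffAt.comp z₀ (hs u)).snd
  have hB : CMDiffAt ∞ (fun z : B × F ↦
      gB.inner z.1 (toBase z (t.symm z v)) (toBase z (t.symm z w))) z₀ := by
    have := ContMDiffAt.clm_bundle_apply₂ (E₃ := Bundle.Trivial B ℝ)
      ((gB.contMDiff z₀.1).comp z₀ contMDiffAt_fst) (hsB v) (hsB w)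
    exact (Bundle.contMDiffAt_totalSpace.1 this).2
  have hF : CMDiffAt ∞ (fun z : B × F ↦
      gF.inner z.2 (toFiber z (t.symm z v)) (toFiber z (t.symm z w))) z₀ := by
    have := ContMDiffAt.clm_bundle_apply₂ (E₃ := Bundle.Trivial F ℝ)
      ((gF.contMDiff z₀.2).comp z₀ contMDiffAt_snd) (hsF v) (hsF w)
    exact (Bundle.contMDiffAt_totalSpace.1 this).2
  exact hB.add ((((hf z₀.1).comp z₀ contMDiffAt_fst).pow 2).mul hF)

/-- The metric `g_B ⊕ f² g_F` of the warped product `B ×_f F` on the manifold `B × F`. -/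
def warpedMetric [FiniteDimensional ℝ EB] [FiniteDimensional ℝ EF]
    (gB : SmoothMetric IB B) (gF : SmoothMetric IF F) (f : B → ℝ) (hf : CMDiff ∞ f)
    (f_pos : ∀ p, 0 < f p) : SmoothMetric (IB.prod IF) (B × F) where
  inner := warpedInner gB gF f
  symm z v w := by rw [warpedInner_apply, warpedInner_apply, gB.symm, gF.symm]
  pos := warpedInner_pos gB gF f f_pos
  isVonNBounded := warpedInner_isVonNBounded gB gF f f_pos
  contMDiff := warpedInner_contMDiff gB gF f hf

/-- The vector field on `B × F` obtained by lifting a vector field on `F`. -/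
def liftFiber (P : Π q : F, TangentSpace IF q) (z : B × F) : TangentSpace (IB.prod IF) z :=
  ofFiber z (P z.2)

end Warped

end

/-! ### Riemannian geometry on a single manifold: brackets, curvature, Ricci tensor -/

noncomputable section Riemannian

open Set VectorField

set_option linter.unusedSectionVars false

variable {E : Type*} [NormedAddCommGroup E] [NormedSpace ℝ E] [FiniteDimensional ℝ E]
  {H : Type*} [TopologicalSpace H] {I : ModelWithCorners ℝ E H}
  {M : Type*} [TopologicalSpace M] [ChartedSpace H M] [IsManifold I ∞ M]

/-! Fix one point `q` of `F`. The Ricci tensor of `F` at `q` does not depend on the base point `p`,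
while the quasi-Einstein equation at `(p, q)` expresses it through `f p`. Comparing these
expressions at two base points forces the values of `f` to agree. Since `B` need not be connected,
`df = 0` alone would not suffice.

Put `N = n₁ + n₂ - 1` and `s = (f p)²`. For the semi-symmetric connection, `Ric̄(v, w) = Ric(v, w) +
N (g(w, ∇_v P) - π(v) π(w))` (`ricci_semiSymmetricConnection`). On vertical vectors the warped
product formulas turn the hypothesis into `Ric_F + h g_F = N s² P♭ ⊗ P♭ + a s g_F + b s u♭ ⊗ u♭`,
where `u = f U` is a `g_F`-unit vector, `♭` is taken with respect to `g_F`, and the number `h`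
vanishes if `df = 0` (`exists_ricci_fiber_eq`).

If `P q = 0`, two base points give two tensors `k g_F + b s u♭ ⊗ u♭` that agree. The rank-one terms
have coefficients of the same sign, so these coefficients are equal
(`SmoothMetric.eq_of_forall_inner_eq`).

If `P q ≠ 0`, the mixed component of the equation reads `N (Xf / f) g(P, V) = 0`, whence `df = 0` on
all of `B` (`mvfderiv_eq_zero_of_parallel_ne_zero`) and `h = 0`. A parallel field satisfies
`Ric_F(·, P) = 0`, so with `ρ = g_F(P, P)` and `κ = g_F(u, P)` one gets `(N s ρ + a) P♭ + b κ u♭ =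
0`. A case distinction on whether `κ` vanishes at each of the two base points then gives equal
values of `s` (`FiberRicciForm.eq_of_parallel`). -/

theorem fderivWithin_comp_extChartAt_symm {φ : M → ℝ} {x : M} {y : E}
    (hy : y ∈ (extChartAt I x).target) (hφ : MDiffAt φ ((extChartAt I x).symm y))
    (X : Π x : M, TangentSpace I x) :
    fderivWithin ℝ (φ ∘ (extChartAt I x).symm) (range I) y
      (mpullbackWithin 𝓘(ℝ, E) I (extChartAt I x).symm X (range I) y)
      = d% φ ((extChartAt I x).symm y) (X ((extChartAt I x).symm y)) := by
  have hinv := isInvertible_mfderivWithin_extChartAt_symm (I := I) hy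
  have hu : UniqueMDiffWithinAt 𝓘(ℝ, E) (range I) y :=
    (I.uniqueDiffOn y (extChartAt_target_subset_range x hy)).uniqueMDiffWithinAt
  have h := mfderiv_comp_mfderivWithin y hφ (mdifferentiableWithinAt_extChartAt_symm hy) hu
  rw [← mfderivWithin_eq_fderivWithin, h]
  have h2 := hinv.self_apply_inverse (X ((extChartAt I x).symm y))
  exact congrArg (mfderiv I 𝓘(ℝ, ℝ) φ ((extChartAt I x).symm y)) h2

theorem contMDiff_mvfderiv {φ : M → ℝ} (hφ : CMDiff ∞ φ) {X : Π x : M, TangentSpace I x}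
    (hX : CMDiff ∞ (T% X)) : CMDiff ∞ (fun y ↦ d% φ y (X y)) :=
  (contMDiff_snd_tangentBundle_modelSpace ℝ 𝓘(ℝ, ℝ) (n := ∞)).comp
    ((hφ.contMDiff_tangentMap (m := ∞) (by simp)).comp hX)

/-- Everything is pulled back to the chart at `x`, where the identity is the symmetry of the second
derivative of `φ`. -/
theorem mvfderiv_mlieBracket {φ : M → ℝ} (hφ : CMDiff ∞ φ) {X Y : Π x : M, TangentSpace I x}
    (hX : CMDiff ∞ (T% X)) (hY : CMDiff ∞ (T% Y)) (x : M) :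
    d% φ x (mlieBracket I X Y x)
      = d% (fun y ↦ d% φ y (Y y)) x (X x) - d% (fun y ↦ d% φ y (X y)) x (Y x) := by
  have hφ' (y : M) : MDiffAt φ y := hφ.mdifferentiableAt (by simp)
  have hmem := mem_extChartAt_target (I := I) x
  have hsymm : (extChartAt I x).symm (extChartAt I x x) = x := extChartAt_to_inv x
  set X' := mpullbackWithin 𝓘(ℝ, E) I (extChartAt I x).symm X (range I) with hX'
  set Y' := mpullbackWithin 𝓘(ℝ, E) I (extChartAt I x).symm Y (range I) with hY'
  have hdiff (Z : Π x : M, TangentSpace I x) (hZ : CMDiff ∞ (T% Z)) :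
      DifferentiableWithinAt ℝ (mpullbackWithin 𝓘(ℝ, E) I (extChartAt I x).symm Z (range I))
        (range I) (extChartAt I x x) := by
    have := ((hZ x).mdifferentiableAt (by simp)).mdifferentiableWithinAt (s := univ)
      |>.differentiableWithinAt_mpullbackWithin_vectorField
    simpa using this
  have hφc : ContDiffWithinAt ℝ ∞ (φ ∘ (extChartAt I x).symm) (range I) (extChartAt I x x) := by
    rw [← contMDiffWithinAt_iff_contDiffWithinAt]
    exact (hφ _).comp_contMDiffWithinAt _
      (contMDiffWithinAt_extChartAt_symm_range x (mem_extChartAt_target x))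
  have hev (Z : Π x : M, TangentSpace I x) :
      (fun y ↦ fderivWithin ℝ (φ ∘ (extChartAt I x).symm) (range I) y
        (mpullbackWithin 𝓘(ℝ, E) I (extChartAt I x).symm Z (range I) y)) =ᶠ[𝓝[range I]
          (extChartAt I x x)] (fun y ↦ d% φ y (Z y)) ∘ (extChartAt I x).symm := by
    filter_upwards [extChartAt_target_mem_nhdsWithin (I := I) x] with y hy
    exact fderivWithin_comp_extChartAt_symm hy (hφ' _) Z
  have hsecond (Z W : Π x : M, TangentSpace I x) (hZ : CMDiff ∞ (T% Z)) :
      fderivWithin ℝ (fun y ↦ fderivWithin ℝ (φ ∘ (extChartAt I x).symm) (range I) y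
        (mpullbackWithin 𝓘(ℝ, E) I (extChartAt I x).symm Z (range I) y)) (range I)
          (extChartAt I x x)
          (mpullbackWithin 𝓘(ℝ, E) I (extChartAt I x).symm W (range I) (extChartAt I x x))
        = d% (fun y ↦ d% φ y (Z y)) x (W x) := by
    rw [(hev Z).fderivWithin_eq ((hev Z).self_of_nhdsWithin (mem_range_self _))]
    have := fderivWithin_comp_extChartAt_symm hmem
      ((contMDiff_mvfderiv hφ hZ).mdifferentiableAt (by simp)) W
    rw [hsymm] at this
    exact this
  have key := fderivWithin_apply_lieBracket hφc (by simpa using ENat.LEInfty.out) I.uniqueDiffOn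
    (I.range_subset_closure_interior (mem_range_self _)) (mem_range_self _) (hdiff Y hY) (hdiff X hX)
  rw [hsecond Y X hY, hsecond X Y hX] at key
  rw [← key, ← mlieBracketWithin_univ, mlieBracketWithin_apply, preimage_univ, univ_inter]
  have hinv : (mfderiv% (extChartAt I x) x).inverse =
      mfderiv[range I] (extChartAt I x).symm (extChartAt I x x) := by
    apply ContinuousLinearMap.inverse_eq
    · exact mfderiv_extChartAt_comp_mfderivWithin_extChartAt_symm' (mem_extChartAt_source x)
    · exact mfderivWithin_extChartAt_symm_comp_mfderiv_extChartAt' (mem_extChartAt_source x)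
  rw [hinv]
  have hu : UniqueMDiffWithinAt 𝓘(ℝ, E) (range I) (extChartAt I x x) :=
    (I.uniqueDiffOn _ (mem_range_self _)).uniqueMDiffWithinAt
  have h := mfderiv_comp_mfderivWithin_of_eq (hφ' x)
    (mdifferentiableWithinAt_extChartAt_symm hmem) hu hsymm
  rw [← mfderivWithin_eq_fderivWithin, h]
  rfl

/-- The extensions in `curvatureAt` are smooth only near `x`. Multiplying by a bump function makes
them globally smooth without changing their germ. -/
theorem exists_contMDiff_eventuallyEq [T2Space M] {x : M} (v : TangentSpace I x) :
    ∃ X : Π x : M, TangentSpace I x, CMDiff ∞ (T% X) ∧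
      X =ᶠ[𝓝 x] FiberBundle.extend (E := fun x : M ↦ TangentSpace I x) E v ∧ X x = v := by
  obtain ⟨s, hs, h⟩ := FiberBundle.exists_contMDiffOn_extend (k := ∞) I E
    (V := fun x : M ↦ TangentSpace I x) v
  obtain ⟨ψ, -, hψ⟩ := (SmoothBumpFunction.nhds_basis_tsupport (I := I) x).mem_iff.1
    (interior_mem_nhds.2 hs)
  refine ⟨(ψ : M → ℝ) • FiberBundle.extend (E := fun x : M ↦ TangentSpace I x) E v, ?_, ?_, ?_⟩
  · exact ContMDiffOn.smul_section_of_tsupport ψ.contMDiff.contMDiffOn isOpen_interior hψ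
      (h.mono interior_subset)
  · filter_upwards [ψ.eventuallyEq_one] with y hy
    simp [hy]
    rfl
  · simp

theorem SmoothMetric.contMDiff_inner (g : SmoothMetric I M) {X Y : Π x : M, TangentSpace I x}
    (hX : CMDiff ∞ (T% X)) (hY : CMDiff ∞ (T% Y)) : CMDiff ∞ (fun y ↦ g.inner y (X y) (Y y)) := by
  intro x
  have := ContMDiffAt.clm_bundle_apply₂ (E₃ := Bundle.Trivial M ℝ)
      (g.contMDiff x) (hX x) (hY x)
  exact (Bundle.contMDiffAt_totalSpace.1 this).2

theorem contMDiff_covariantDerivative {nabla : LinearConnection I M}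
    (h : CovariantDerivative.ContMDiffCovariantDerivative nabla ∞) {X Y : Π x : M, TangentSpace I x}
    (hX : CMDiff ∞ (T% X)) (hY : CMDiff ∞ (T% Y)) : CMDiff ∞ (T% (fun y ↦ nabla Y y (X y))) := by
  intro x
  have := (h.contMDiff.contMDiff (σ := Y) (by exact hY.contMDiffOn) x (by trivial)).contMDiffAt
    (by simp)
  exact this.clm_bundle_apply (hX x)

/-! ### Linear algebra of the metric -/

section Metric

theorem SmoothMetric.ext_inner (g : SmoothMetric I M) {x : M} {u v : TangentSpace I x}
    (h : ∀ w, g.inner x u w = g.inner x v w) : u = v := by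
  by_contra hne
  have := g.pos x (u - v) (sub_ne_zero.2 hne)
  simp [h] at this

theorem repr_eq_inner (g : SmoothMetric I M) {x : M} {ι : Type*} [Fintype ι] [DecidableEq ι]
    (b : Module.Basis ι ℝ (TangentSpace I x))
    (hb : ∀ i j, g.inner x (b i) (b j) = if i = j then 1 else 0) (v : TangentSpace I x) (i : ι) :
    b.repr v i = g.inner x v (b i) := by
  conv_rhs => rw [← b.sum_repr v]
  simp [hb, -Module.Basis.sum_repr]

theorem sum_inner_eq_trace (g : SmoothMetric I M) {x : M} {ι : Type*} [Fintype ι] [DecidableEq ι]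
    (b : Module.Basis ι ℝ (TangentSpace I x))
    (hb : ∀ i j, g.inner x (b i) (b j) = if i = j then 1 else 0)
    (L : TangentSpace I x →ₗ[ℝ] TangentSpace I x) :
    ∑ i, g.inner x (L (b i)) (b i) = LinearMap.trace ℝ _ L := by
  rw [LinearMap.trace_eq_matrix_trace ℝ b, Matrix.trace]
  refine Finset.sum_congr rfl fun i _ ↦ ?_
  rw [Matrix.diag_apply, LinearMap.toMatrix_apply, repr_eq_inner g b hb]

end Metric

/-! ### Locality and tensoriality of curvature -/

section Curvature

variable {nabla : LinearConnection I M}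

theorem CovariantDerivative.congr_of_eventuallyEq {Z Z' : Π x : M, TangentSpace I x} {x : M}
    (hZ : MDiffAt (T% Z) x) (h : Z' =ᶠ[𝓝 x] Z) : nabla Z' x = nabla Z x := by
  have hZ' : MDiffAt (T% Z') x :=
    hZ.congr_of_eventuallyEq (h.mono fun y hy ↦ by simp only [hy])
  exact nabla.isCovariantDerivativeOnUniv.congr_of_eventuallyEq hZ' hZ Filter.univ_mem h

theorem curvature_congr_of_eventuallyEq
    (hs : ∀ A B : Π x : M, TangentSpace I x, CMDiff ∞ (T% A) → CMDiff ∞ (T% B) →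
      CMDiff ∞ (T% (fun y ↦ nabla B y (A y))))
    {X X' Y Y' Z Z' : Π x : M, TangentSpace I x} {x : M}
    (hX : CMDiff ∞ (T% X)) (hY : CMDiff ∞ (T% Y)) (hZ : CMDiff ∞ (T% Z))
    (hXX' : X' =ᶠ[𝓝 x] X) (hYY' : Y' =ᶠ[𝓝 x] Y) (hZZ' : Z' =ᶠ[𝓝 x] Z) :
    curvature nabla X' Y' Z' x = curvature nabla X Y Z x := by
  have hd {A : Π x : M, TangentSpace I x} (hA : CMDiff ∞ (T% A)) (y : M) : MDiffAt (T% A) y :=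
    (hA y).mdifferentiableAt (by simp)
  have hev {A A' : Π x : M, TangentSpace I x} (hAA' : A' =ᶠ[𝓝 x] A) :
      (fun y ↦ nabla Z' y (A' y)) =ᶠ[𝓝 x] (fun y ↦ nabla Z y (A y)) := by
    filter_upwards [hZZ'.eventuallyEq_nhds, hAA'] with y hy hy'
    rw [CovariantDerivative.congr_of_eventuallyEq (hd hZ y) hy, hy']
  unfold curvature
  rw [CovariantDerivative.congr_of_eventuallyEq (hd (hs _ _ hY hZ) x) (hev hYY'),
    CovariantDerivative.congr_of_eventuallyEq (hd (hs _ _ hX hZ) x) (hev hXX'),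
    CovariantDerivative.congr_of_eventuallyEq (hd hZ x) hZZ', hXX'.mlieBracket_vectorField_eq hYY',
    hXX'.self_of_nhds, hYY'.self_of_nhds]

/-- The fields are chosen before the connection, so that the same extensions serve for `∇` and for
the semi-symmetric connection. -/
theorem exists_curvatureAt_eq [T2Space M] {x : M} (u v w : TangentSpace I x) :
    ∃ X Y Z : Π x : M, TangentSpace I x, CMDiff ∞ (T% X) ∧ CMDiff ∞ (T% Y) ∧ CMDiff ∞ (T% Z) ∧
      X x = u ∧ Y x = v ∧ Z x = w ∧ ∀ nabla : LinearConnection I M,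
        (∀ A B : Π x : M, TangentSpace I x, CMDiff ∞ (T% A) → CMDiff ∞ (T% B) →
          CMDiff ∞ (T% (fun y ↦ nabla B y (A y)))) →
        curvatureAt nabla x u v w = curvature nabla X Y Z x := by
  obtain ⟨X, hX, hXe, hXx⟩ := exists_contMDiff_eventuallyEq u
  obtain ⟨Y, hY, hYe, hYx⟩ := exists_contMDiff_eventuallyEq v
  obtain ⟨Z, hZ, hZe, hZx⟩ := exists_contMDiff_eventuallyEq w
  exact ⟨X, Y, Z, hX, hY, hZ, hXx, hYx, hZx, fun nabla hs ↦
    curvature_congr_of_eventuallyEq hs hX hY hZ hXe.symm hYe.symm hZe.symm⟩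

theorem curvature_swap (X Y Z : Π x : M, TangentSpace I x) (x : M) :
    curvature nabla X Y Z x = - curvature nabla Y X Z x := by
  unfold curvature
  rw [mlieBracket_swap_apply, map_neg]
  abel

/-- The term with the derivative of `f` in `∇_Y (f ∇_X Z)` cancels against the one in `∇_[fX, Y] Z`.
-/
theorem tensorialAt_curvature (h : CovariantDerivative.ContMDiffCovariantDerivative nabla ∞)
    {Y Z : Π x : M, TangentSpace I x} (hZ : CMDiff ∞ (T% Z)) (x : M) :
    TensorialAt I E (fun X ↦ curvature nabla X Y Z x) x := by
  have hd {X : Π x : M, TangentSpace I x} (hX : MDiffAt (T% X) x) :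
      MDiffAt (T% (fun y ↦ nabla Z y (X y))) x := by
    have := (((h.contMDiff.contMDiff (σ := Z) (by exact hZ.contMDiffOn) x
      (by trivial)).contMDiffAt (by simp)).mdifferentiableAt (by simp))
    exact this.clm_bundle_apply hX
  refine ⟨fun {f X} hf hX ↦ ?_, fun {X X'} hX hX' ↦ ?_⟩
  · have h1 : (fun y ↦ nabla Z y ((f • X) y)) = f • (fun y ↦ nabla Z y (X y)) := by
      ext y; simp
    unfold curvature
    rw [h1, nabla.isCovariantDerivativeOnUniv.leibniz (hd hX) hf, mlieBracket_smul_left hf hX]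
    simp
    module
  · have h1 : (fun y ↦ nabla Z y ((X + X') y))
        = (fun y ↦ nabla Z y (X y)) + (fun y ↦ nabla Z y (X' y)) := by
      ext y; simp
    unfold curvature
    rw [h1, nabla.isCovariantDerivativeOnUniv.add (hd hX) (hd hX'), mlieBracket_add_left hX hX']
    simp
    abel

theorem curvature_congr₁₂ (h : CovariantDerivative.ContMDiffCovariantDerivative nabla ∞)
    {X X' Y Y' Z : Π x : M, TangentSpace I x} (hX : CMDiff ∞ (T% X)) (hX' : CMDiff ∞ (T% X'))
    (hY : CMDiff ∞ (T% Y)) (hY' : CMDiff ∞ (T% Y')) (hZ : CMDiff ∞ (T% Z)) {x : M}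
    (hXX' : X x = X' x) (hYY' : Y x = Y' x) :
    curvature nabla X Y Z x = curvature nabla X' Y' Z x := by
  have hd {A : Π x : M, TangentSpace I x} (hA : CMDiff ∞ (T% A)) (y : M) : MDiffAt (T% A) y :=
    (hA y).mdifferentiableAt (by simp)
  rw [(tensorialAt_curvature h hZ x).pointwise (hd hX x) (hd hX' x) hXX', curvature_swap,
    (tensorialAt_curvature h hZ x).pointwise (hd hY x) (hd hY' x) hYY', ← curvature_swap]

end Curvature

/-! ### Levi-Civita connection, its curvature and Ricci tensor -/

section LeviCivita

variable {g : SmoothMetric I M} {nabla : LinearConnection I M}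

theorem IsLeviCivita.sub_eq_mlieBracket (h : IsLeviCivita g nabla) {X Y : Π x : M, TangentSpace I x}
    (hX : CMDiff ∞ (T% X)) (hY : CMDiff ∞ (T% Y)) (x : M) :
    nabla Y x (X x) - nabla X x (Y x) = mlieBracket I X Y x :=
  nabla.torsion_eq_zero_iff.1 h.torsion_free ((hX x).mdifferentiableAt (by simp))
    ((hY x).mdifferentiableAt (by simp))

theorem IsLeviCivita.mvfderiv_inner (h : IsLeviCivita g nabla) {Y Z : Π x : M, TangentSpace I x}
    (hY : CMDiff ∞ (T% Y)) (hZ : CMDiff ∞ (T% Z)) (x : M) (v : TangentSpace I x) :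
    d% (fun y ↦ g.inner y (Y y) (Z y)) x v
      = g.inner x (nabla Y x v) (Z x) + g.inner x (Y x) (nabla Z x v) :=
  h.metric ((hY x).mdifferentiableAt (by simp)) ((hZ x).mdifferentiableAt (by simp)) v

theorem IsLeviCivita.contMDiff_apply (h : IsLeviCivita g nabla) {X Y : Π x : M, TangentSpace I x}
    (hX : CMDiff ∞ (T% X)) (hY : CMDiff ∞ (T% Y)) : CMDiff ∞ (T% (fun y ↦ nabla Y y (X y))) :=
  contMDiff_covariantDerivative h.smooth hX hY

/-- The Koszul formula. -/
theorem IsLeviCivita.koszul (h : IsLeviCivita g nabla) {X Y Z : Π x : M, TangentSpace I x}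
    (hX : CMDiff ∞ (T% X)) (hY : CMDiff ∞ (T% Y)) (hZ : CMDiff ∞ (T% Z)) (x : M) :
    2 * g.inner x (nabla Y x (X x)) (Z x) =
      d% (fun y ↦ g.inner y (Y y) (Z y)) x (X x) + d% (fun y ↦ g.inner y (X y) (Z y)) x (Y x)
        - d% (fun y ↦ g.inner y (X y) (Y y)) x (Z x) + g.inner x (mlieBracket I X Y x) (Z x)
        - g.inner x (mlieBracket I X Z x) (Y x) - g.inner x (mlieBracket I Y Z x) (X x) := by
  rw [h.mvfderiv_inner hY hZ, h.mvfderiv_inner hX hZ, h.mvfderiv_inner hX hY,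
    ← h.sub_eq_mlieBracket hX hY, ← h.sub_eq_mlieBracket hX hZ, ← h.sub_eq_mlieBracket hY hZ]
  simp only [map_sub, _root_.sub_apply]
  rw [g.symm x (nabla X x (Z x)) (Y x), g.symm x (nabla Z x (X x)) (Y x),
    g.symm x (nabla Z x (Y x)) (X x), g.symm x (nabla Y x (Z x)) (X x)]
  ring

theorem mvfderiv_fun_add_apply {φ ψ : M → ℝ} (hφ : CMDiff ∞ φ) (hψ : CMDiff ∞ ψ) (x : M)
    (v : TangentSpace I x) : d% (fun y ↦ φ y + ψ y) x v = d% φ x v + d% ψ x v := by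
  have := mvfderiv_add ((hφ x).mdifferentiableAt (by simp)) ((hψ x).mdifferentiableAt (by simp))
  exact congr($this v)

theorem mvfderiv_fun_mul_apply {φ ψ : M → ℝ} (hφ : CMDiff ∞ φ) (hψ : CMDiff ∞ ψ) (x : M)
    (v : TangentSpace I x) : d% (fun y ↦ φ y * ψ y) x v = φ x * d% ψ x v + ψ x * d% φ x v := by
  have := mvfderiv_mul ((hφ x).mdifferentiableAt (by simp)) ((hψ x).mdifferentiableAt (by simp))
  exact congr($this v)

theorem IsLeviCivita.inner_nabla_nabla (h : IsLeviCivita g nabla)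
    {X Y Z W : Π x : M, TangentSpace I x} (hY : CMDiff ∞ (T% Y))
    (hZ : CMDiff ∞ (T% Z)) (hW : CMDiff ∞ (T% W)) (x : M) :
    g.inner x (nabla (fun y ↦ nabla Z y (Y y)) x (X x)) (W x) =
      d% (fun y ↦ g.inner y (nabla Z y (Y y)) (W y)) x (X x)
        - g.inner x (nabla Z x (Y x)) (nabla W x (X x)) := by
  rw [h.mvfderiv_inner (h.contMDiff_apply hY hZ) hW]
  ring

/-- Apply `[X, Y]` and the commutator of `X` and `Y` to the function `g(Z, W)` and expand both with
metric compatibility. The mixed first-order terms cancel. -/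
theorem IsLeviCivita.inner_curvature_skew (h : IsLeviCivita g nabla)
    {X Y Z W : Π x : M, TangentSpace I x} (hX : CMDiff ∞ (T% X)) (hY : CMDiff ∞ (T% Y))
    (hZ : CMDiff ∞ (T% Z)) (hW : CMDiff ∞ (T% W)) (x : M) :
    g.inner x (curvature nabla X Y Z x) (W x) = - g.inner x (Z x) (curvature nabla X Y W x) := by
  have hZW := g.contMDiff_inner hZ hW
  have key := mvfderiv_mlieBracket hZW hX hY x
  have h1 (A : Π x : M, TangentSpace I x) : (fun y ↦ d% (fun y ↦ g.inner y (Z y) (W y)) y (A y)) =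
      (fun y ↦ g.inner y (nabla Z y (A y)) (W y) + g.inner y (Z y) (nabla W y (A y))) :=
    funext fun y ↦ h.mvfderiv_inner hZ hW y _
  rw [h1 X, h1 Y, h.mvfderiv_inner hZ hW,
    mvfderiv_fun_add_apply (g.contMDiff_inner (h.contMDiff_apply hY hZ) hW)
      (g.contMDiff_inner hZ (h.contMDiff_apply hY hW)),
    mvfderiv_fun_add_apply (g.contMDiff_inner (h.contMDiff_apply hX hZ) hW)
      (g.contMDiff_inner hZ (h.contMDiff_apply hX hW)),
    h.mvfderiv_inner (h.contMDiff_apply hY hZ) hW, h.mvfderiv_inner hZ (h.contMDiff_apply hY hW),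
    h.mvfderiv_inner (h.contMDiff_apply hX hZ) hW, h.mvfderiv_inner hZ (h.contMDiff_apply hX hW)]
    at key
  unfold curvature
  simp only [map_sub, _root_.sub_apply]
  linarith

variable [T2Space M]

theorem exists_contMDiff_apply_eq {x : M} (v : TangentSpace I x) :
    ∃ X : Π x : M, TangentSpace I x, CMDiff ∞ (T% X) ∧ X x = v :=
  let ⟨X, hX, _, hv⟩ := exists_contMDiff_eventuallyEq v
  ⟨X, hX, hv⟩

theorem IsLeviCivita.curvatureAt_eq (h : IsLeviCivita g nabla) {X Y Z : Π x : M, TangentSpace I x}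
    (hX : CMDiff ∞ (T% X)) (hY : CMDiff ∞ (T% Y)) (hZ : CMDiff ∞ (T% Z)) (x : M) :
    curvatureAt nabla x (X x) (Y x) (Z x) = curvature nabla X Y Z x := by
  obtain ⟨X', Y', Z', hX', hY', hZ', hXx, hYx, hZx, hc⟩ := exists_curvatureAt_eq (X x) (Y x) (Z x)
  rw [hc nabla fun A B hA hB ↦ h.contMDiff_apply hA hB,
    curvature_congr₁₂ h.smooth hX' hX hY' hY hZ' hXx hYx]
  -- Independence of the extension in the third slot: skew-symmetry moves the curvature onto `W`,
  -- leaving only the value of the field at `x`.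
  refine g.ext_inner fun w ↦ ?_
  obtain ⟨W, hW, rfl⟩ := exists_contMDiff_apply_eq w
  rw [h.inner_curvature_skew hX hY hZ' hW, hZx, ← h.inner_curvature_skew hX hY hZ hW]

theorem IsLeviCivita.inner_curvatureAt_skew (h : IsLeviCivita g nabla) {x : M}
    (u v w w' : TangentSpace I x) :
    g.inner x (curvatureAt nabla x u v w) w' = - g.inner x w (curvatureAt nabla x u v w') := by
  obtain ⟨X, hX, rfl⟩ := exists_contMDiff_apply_eq u
  obtain ⟨Y, hY, rfl⟩ := exists_contMDiff_apply_eq v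
  obtain ⟨Z, hZ, rfl⟩ := exists_contMDiff_apply_eq w
  obtain ⟨W, hW, rfl⟩ := exists_contMDiff_apply_eq w'
  rw [h.curvatureAt_eq hX hY hZ, h.curvatureAt_eq hX hY hW, h.inner_curvature_skew hX hY hZ hW]

/-- The linear map `e ↦ R(v, e)w` whose trace is the Ricci tensor. -/
def IsLeviCivita.ricciMap (h : IsLeviCivita g nabla) (x : M) (v w : TangentSpace I x) :
    TangentSpace I x →ₗ[ℝ] TangentSpace I x where
  toFun e := curvatureAt nabla x v e w
  map_add' e e' := by
    obtain ⟨V, hV, rfl⟩ := exists_contMDiff_apply_eq v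
    obtain ⟨W, hW, rfl⟩ := exists_contMDiff_apply_eq w
    obtain ⟨Y, hY, rfl⟩ := exists_contMDiff_apply_eq e
    obtain ⟨Y', hY', rfl⟩ := exists_contMDiff_apply_eq e'
    have := (tensorialAt_curvature (Y := V) h.smooth hW x).add ((hY x).mdifferentiableAt (by simp))
      ((hY' x).mdifferentiableAt (by simp))
    rw [show Y x + Y' x = (Y + Y') x from rfl, h.curvatureAt_eq hV hY hW,
      h.curvatureAt_eq hV hY' hW, h.curvatureAt_eq hV (hY.add_section hY') hW,
      curvature_swap, this, curvature_swap Y V, curvature_swap Y' V]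
    abel
  map_smul' c e := by
    obtain ⟨V, hV, rfl⟩ := exists_contMDiff_apply_eq v
    obtain ⟨W, hW, rfl⟩ := exists_contMDiff_apply_eq w
    obtain ⟨Y, hY, rfl⟩ := exists_contMDiff_apply_eq e
    have := (tensorialAt_curvature (Y := V) h.smooth hW x).smul (f := fun _ ↦ c)
      mdifferentiableAt_const ((hY x).mdifferentiableAt (by simp))
    rw [show c • Y x = ((fun _ : M ↦ c) • Y) x from rfl, h.curvatureAt_eq hV hY hW,
      h.curvatureAt_eq hV (contMDiff_const.smul_section hY) hW,
      curvature_swap, this, curvature_swap Y V]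
    simp

theorem IsLeviCivita.ricciMap_apply (h : IsLeviCivita g nabla) (x : M) (v w e : TangentSpace I x) :
    h.ricciMap x v w e = curvatureAt nabla x v e w := rfl

/-- Being a trace, the Ricci tensor may be computed in any orthonormal basis, in particular in one
adapted to a product. -/
theorem IsLeviCivita.ricci_eq_sum (h : IsLeviCivita g nabla) {x : M} {ι : Type*} [Fintype ι]
    [DecidableEq ι] (b : Module.Basis ι ℝ (TangentSpace I x))
    (hb : ∀ i j, g.inner x (b i) (b j) = if i = j then 1 else 0) (v w : TangentSpace I x) :
    ricci g nabla x v w = ∑ i, g.inner x (curvatureAt nabla x v (b i) w) (b i) :=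
  (sum_inner_eq_trace g _ (orthonormalBasisAt_inner g x) (h.ricciMap x v w)).trans
    (sum_inner_eq_trace g b hb (h.ricciMap x v w)).symm

theorem IsLeviCivita.curvatureAt_of_parallel (h : IsLeviCivita g nabla)
    {P : Π x : M, TangentSpace I x} (hP : CMDiff ∞ (T% P))
    (hpar : ∀ (x : M) (v : TangentSpace I x), nabla P x v = 0) (x : M) (u v : TangentSpace I x) :
    curvatureAt nabla x u v (P x) = 0 := by
  obtain ⟨X, hX, rfl⟩ := exists_contMDiff_apply_eq u
  obtain ⟨Y, hY, rfl⟩ := exists_contMDiff_apply_eq v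
  have h0 (A : Π x : M, TangentSpace I x) : (fun y ↦ nabla P y (A y)) = 0 :=
    funext fun y ↦ hpar y _
  rw [h.curvatureAt_eq hX hY hP]
  unfold curvature
  rw [h0, h0, hpar]
  simp

theorem IsLeviCivita.ricci_of_parallel (h : IsLeviCivita g nabla)
    {P : Π x : M, TangentSpace I x} (hP : CMDiff ∞ (T% P))
    (hpar : ∀ (x : M) (v : TangentSpace I x), nabla P x v = 0) (x : M) (v : TangentSpace I x) :
    ricci g nabla x v (P x) = 0 := by
  unfold ricci
  simp [h.curvatureAt_of_parallel hP hpar]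

end LeviCivita

section Riesz

theorem SmoothMetric.exists_inner_eq (g : SmoothMetric I M) (x : M)
    (ℓ : TangentSpace I x →L[ℝ] ℝ) : ∃ G : TangentSpace I x, ∀ u, g.inner x G u = ℓ u := by
  set b := orthonormalBasisAt g x with hb
  refine ⟨∑ i, ℓ (b i) • b i, fun u ↦ ?_⟩
  conv_rhs => rw [← b.sum_repr u]
  simp only [map_sum, map_smul, _root_.sum_apply, _root_.smul_apply, smul_eq_mul]
  refine Finset.sum_congr rfl fun i _ ↦ ?_
  rw [repr_eq_inner g b (orthonormalBasisAt_inner g x), g.symm, mul_comm]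

theorem SmoothMetric.sum_inner_mul_inner (g : SmoothMetric I M) (x : M)
    (u u' : TangentSpace I x) :
    ∑ i, g.inner x u (orthonormalBasisAt g x i) * g.inner x u' (orthonormalBasisAt g x i)
      = g.inner x u u' := by
  conv_rhs => rw [← (orthonormalBasisAt g x).sum_repr u']
  simp only [map_sum, map_smul, smul_eq_mul]
  refine Finset.sum_congr rfl fun i _ ↦ ?_
  rw [repr_eq_inner g _ (orthonormalBasisAt_inner g x), mul_comm]

end Riesz

/-! ### Curvature and Ricci tensor of the semi-symmetric connection -/

section SemiSymmetric

variable {g : SmoothMetric I M} {nabla : LinearConnection I M}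

theorem contMDiff_semiSymmetricConnection (h : IsLeviCivita g nabla)
    {P X Z : Π x : M, TangentSpace I x} (hP : CMDiff ∞ (T% P)) (hX : CMDiff ∞ (T% X))
    (hZ : CMDiff ∞ (T% Z)) :
    CMDiff ∞ (T% (fun y ↦ semiSymmetricConnection g nabla P Z y (X y))) := by
  have := (h.contMDiff_apply hX hZ).add_section ((g.contMDiff_inner hZ hP).smul_section hX)
  simp only [semiSymmetricConnection_apply]
  exact this

theorem curvature_semiSymmetricConnection (h : IsLeviCivita g nabla)
    {P X Y Z : Π x : M, TangentSpace I x} (hP : CMDiff ∞ (T% P)) (hX : CMDiff ∞ (T% X))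
    (hY : CMDiff ∞ (T% Y)) (hZ : CMDiff ∞ (T% Z)) (x : M) :
    curvature (semiSymmetricConnection g nabla P) X Y Z x = curvature nabla X Y Z x
      + (g.inner x (Z x) (nabla P x (X x)) - g.inner x (X x) (P x) * g.inner x (Z x) (P x)) • Y x
      - (g.inner x (Z x) (nabla P x (Y x)) - g.inner x (Y x) (P x) * g.inner x (Z x) (P x)) • X x := by
  have hd {A : Π x : M, TangentSpace I x} (hA : CMDiff ∞ (T% A)) (y : M) : MDiffAt (T% A) y :=
    (hA y).mdifferentiableAt (by simp)
  have hπ := g.contMDiff_inner hZ hP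
  have key {A : Π x : M, TangentSpace I x} (hA : CMDiff ∞ (T% A)) (v : TangentSpace I x) :
      nabla (fun y ↦ semiSymmetricConnection g nabla P Z y (A y)) x v
        = nabla (fun y ↦ nabla Z y (A y)) x v + g.inner x (Z x) (P x) • nabla A x v
          + (g.inner x (nabla Z x v) (P x) + g.inner x (Z x) (nabla P x v)) • A x := by
    have h1 : (fun y ↦ semiSymmetricConnection g nabla P Z y (A y))
        = (fun y ↦ nabla Z y (A y)) + (fun y ↦ g.inner y (Z y) (P y)) • A := by
      ext y; simp only [semiSymmetricConnection_apply]; rfl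
    rw [h1, nabla.isCovariantDerivativeOnUniv.add (hd (h.contMDiff_apply hA hZ) x)
      (hd (hπ.smul_section hA) x), nabla.isCovariantDerivativeOnUniv.leibniz (hd hA x)
      ((hπ x).mdifferentiableAt (by simp)), ← h.mvfderiv_inner hZ hP]
    simp only [_root_.add_apply, _root_.smul_apply, ContinuousLinearMap.smulRight_apply]
    abel
  unfold curvature
  rw [semiSymmetricConnection_apply, semiSymmetricConnection_apply, semiSymmetricConnection_apply,
    key hX, key hY, semiSymmetricConnection_apply, semiSymmetricConnection_apply,
    ← h.sub_eq_mlieBracket hX hY]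
  simp only [map_add, map_smul, map_sub, _root_.add_apply, _root_.smul_apply, smul_eq_mul]
  module

variable [T2Space M]

/-- In the trace over `e`, the correction proportional to `e` counts `dim M` times. The one
proportional to `v` contracts to the same quantity once, with a minus sign. -/
theorem ricci_semiSymmetricConnection (h : IsLeviCivita g nabla) {P : Π x : M, TangentSpace I x}
    (hP : CMDiff ∞ (T% P)) (x : M) (v w : TangentSpace I x) :
    ricci g (semiSymmetricConnection g nabla P) x v w = ricci g nabla x v w
      + ((Module.finrank ℝ E : ℝ) - 1)
        * (g.inner x w (nabla P x v) - g.inner x v (P x) * g.inner x w (P x)) := by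
  have hc (e : TangentSpace I x) : curvatureAt (semiSymmetricConnection g nabla P) x v e w =
      curvatureAt nabla x v e w
        + (g.inner x w (nabla P x v) - g.inner x v (P x) * g.inner x w (P x)) • e
        - (g.inner x w (nabla P x e) - g.inner x e (P x) * g.inner x w (P x)) • v := by
    obtain ⟨X, Y, Z, hX, hY, hZ, rfl, rfl, rfl, hR⟩ := exists_curvatureAt_eq v e w
    rw [hR _ fun A B hA hB ↦ contMDiff_semiSymmetricConnection h hP hA hB,
      hR _ fun A B hA hB ↦ h.contMDiff_apply hA hB, curvature_semiSymmetricConnection h hP hX hY hZ]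
  set b := orthonormalBasisAt g x with hbdef
  have hb := orthonormalBasisAt_inner g x
  have hv : v = ∑ i, g.inner x v (b i) • b i := by
    conv_lhs => rw [← b.sum_repr v]
    exact Finset.sum_congr rfl fun i _ ↦ by rw [repr_eq_inner g b hb]
  have htr : ∑ i, (g.inner x w (nabla P x (b i)) - g.inner x (b i) (P x) * g.inner x w (P x))
      * g.inner x v (b i)
        = g.inner x w (nabla P x v) - g.inner x v (P x) * g.inner x w (P x) := by
    have h1 : g.inner x w (nabla P x v) = ∑ i, g.inner x v (b i) * g.inner x w (nabla P x (b i)) := by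
      conv_lhs => rw [hv]
      simp [map_sum]
    have h2 : g.inner x v (P x) = ∑ i, g.inner x v (b i) * g.inner x (b i) (P x) := by
      conv_lhs => rw [hv]
      simp [map_sum]
    rw [h1, h2, Finset.sum_mul, ← Finset.sum_sub_distrib]
    exact Finset.sum_congr rfl fun i _ ↦ by ring
  unfold ricci
  simp only [hc, map_sub, map_add, map_smul, _root_.add_apply, _root_.sub_apply, _root_.smul_apply,
    smul_eq_mul, Finset.sum_add_distrib, Finset.sum_sub_distrib]
  rw [← hbdef]
  have hn : ∑ i, g.inner x (b i) (b i) = (Module.finrank ℝ E : ℝ) := by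
    simp [hb, hbdef]
  rw [htr, ← Finset.mul_sum, hn]
  ring

end SemiSymmetric

/-- Cut-off linear functionals of the chart are smooth functions whose differentials separate
tangent vectors. This lets brackets on a product be identified through their action on functions. -/
theorem ext_mvfderiv [T2Space M] {x : M} {u v : TangentSpace I x}
    (h : ∀ φ : M → ℝ, CMDiff ∞ φ → d% φ x u = d% φ x v) : u = v := by
  obtain ⟨ψ⟩ : Nonempty (SmoothBumpFunction I x) := inferInstance
  have hl (ℓ : E →L[ℝ] ℝ) : ℓ u = ℓ v := by
    have hs : CMDiff ∞ (fun y ↦ ψ y • ℓ (extChartAt I x y)) := by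
      refine ψ.contMDiff_smul ?_
      exact ℓ.contMDiff.comp_contMDiffOn (contMDiffOn_extChartAt)
    have hd (w : TangentSpace I x) : d% (fun y ↦ ψ y • ℓ (extChartAt I x y)) x w = ℓ w := by
      have he : (fun y ↦ ψ y • ℓ (extChartAt I x y)) =ᶠ[𝓝 x] ℓ ∘ extChartAt I x := by
        filter_upwards [ψ.eventuallyEq_one] with y hy
        simp [hy]
      have h1 := he.mfderiv_eq (I := I) (I' := 𝓘(ℝ, ℝ))
      have h2 := mfderiv_comp_apply (I := I) (I' := 𝓘(ℝ, E)) (I'' := 𝓘(ℝ, ℝ)) x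
        (ℓ.contMDiff.mdifferentiableAt (n := ∞) (by simp))
        (mdifferentiableAt_extChartAt (mem_chart_source H x)) w
      rw [mfderiv_extChartAt_self] at h2
      have h3 : mfderiv 𝓘(ℝ, E) 𝓘(ℝ, ℝ) ℓ (extChartAt I x x) = ℓ := by
        rw [mfderiv_eq_fderiv]; exact ℓ.fderiv
      rw [h3] at h2
      exact (congr($h1 w)).trans h2
    have := h _ hs
    rwa [hd, hd] at this
  by_contra hne
  obtain ⟨ℓ, hℓ⟩ := SeparatingDual.exists_separating_of_ne (R := ℝ) (V := E) hne
  exact hℓ (hl ℓ)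

/-! ### Comparison of two expressions for the Ricci tensor at one point -/

section Pointwise

theorem SmoothMetric.exists_ne_zero_inner_eq_zero (hE : 2 ≤ Module.finrank ℝ E)
    (g : SmoothMetric I M) (x : M) (u : TangentSpace I x) :
    ∃ v : TangentSpace I x, v ≠ 0 ∧ g.inner x v u = 0 := by
  have h : LinearMap.ker ((g.inner x u : TangentSpace I x →L[ℝ] ℝ) : TangentSpace I x →ₗ[ℝ] ℝ)
      ≠ ⊥ := by
    have : FiniteDimensional ℝ (TangentSpace I x) := inferInstanceAs (FiniteDimensional ℝ E)
    refine LinearMap.ker_ne_bot_of_finrank_lt ?_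
    rw [Module.finrank_self]
    exact hE
  obtain ⟨v, hv, hv0⟩ := (Submodule.ne_bot_iff _).1 h
  exact ⟨v, hv0, by rw [g.symm]; exact hv⟩

/-- If two rank-one perturbations of multiples of `g` with coefficients of the same sign agree, then
these coefficients are equal. -/
theorem SmoothMetric.eq_of_forall_inner_eq (hE : 2 ≤ Module.finrank ℝ E) (g : SmoothMetric I M)
    {x : M} {u₁ u₂ : TangentSpace I x} (hu₁ : g.inner x u₁ u₁ = 1) (hu₂ : g.inner x u₂ u₂ = 1)
    {b k₁ k₂ s₁ s₂ : ℝ} (hb : b ≠ 0) (hs₁ : 0 < s₁) (hs₂ : 0 < s₂)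
    (h : ∀ v, k₁ * g.inner x v v + b * s₁ * g.inner x v u₁ ^ 2
      = k₂ * g.inner x v v + b * s₂ * g.inner x v u₂ ^ 2) : s₁ = s₂ := by
  have hb2 : 0 < b ^ 2 := by positivity
  -- Testing on a vector orthogonal to `u₁` gives `b (k₁ - k₂) ≥ 0`; on a vector orthogonal to `u₂`,
  -- the reverse inequality.
  have hk : k₁ = k₂ := by
    obtain ⟨v, hv, hvu⟩ := g.exists_ne_zero_inner_eq_zero hE x u₁
    obtain ⟨w, hw, hwu⟩ := g.exists_ne_zero_inner_eq_zero hE x u₂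
    have h1 := h v
    have h2 := h w
    rw [hvu] at h1
    rw [hwu] at h2
    have hv' := g.pos x v hv
    have hw' := g.pos x w hw
    have h3 : 0 ≤ b * (k₁ - k₂) * g.inner x v v := by
      have : b * (k₁ - k₂) * g.inner x v v = b ^ 2 * (s₂ * g.inner x v u₂ ^ 2) := by
        linear_combination b * h1
      rw [this]
      positivity
    have h4 : 0 ≤ - (b * (k₁ - k₂)) * g.inner x w w := by
      have : - (b * (k₁ - k₂)) * g.inner x w w = b ^ 2 * (s₁ * g.inner x w u₁ ^ 2) := by
        linear_combination - b * h2
      rw [this]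
      positivity
    have h5 := nonneg_of_mul_nonneg_left h3 hv'
    have h6 := nonneg_of_mul_nonneg_left h4 hw'
    have h7 : b * (k₁ - k₂) = 0 := by linarith
    exact sub_eq_zero.1 ((mul_eq_zero.1 h7).resolve_left hb)
  have h1 := h u₁
  have h2 := h u₂
  rw [hu₁, hk] at h1
  rw [hu₂, hk, g.symm x u₂ u₁] at h2
  -- With the multiples of `g` removed, testing on `u₁` and `u₂` gives `s₁ = s₂ t` and `s₁ t = s₂`;
  -- positivity forces `t = 1`.
  set t := g.inner x u₁ u₂ ^ 2
  have ht : 0 ≤ t := sq_nonneg _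
  have e1 : s₁ = s₂ * t := mul_left_cancel₀ hb (by linear_combination h1)
  have e2 : s₁ * t = s₂ := mul_left_cancel₀ hb (by linear_combination h2)
  have e3 : (s₁ + s₂) * (t - 1) = 0 := by linear_combination e2 - e1
  have e4 : t = 1 := by
    have := (mul_eq_zero.1 e3).resolve_left (by positivity)
    linarith
  rw [e1, e4, mul_one]

variable [T2Space M] {g : SmoothMetric I M} {nabla : LinearConnection I M}

/-- The Ricci tensor vanishes in a direction that spans the tangent space together with a parallel
field. -/
theorem IsLeviCivita.ricci_self_eq_zero (h : IsLeviCivita g nabla)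
    {P : Π x : M, TangentSpace I x} (hP : CMDiff ∞ (T% P))
    (hpar : ∀ (x : M) (v : TangentSpace I x), nabla P x v = 0) {x : M} {u : TangentSpace I x}
    (hspan : ∀ v : TangentSpace I x, ∃ α β : ℝ, v = α • P x + β • u) :
    ricci g nabla x u u = 0 := by
  refine Finset.sum_eq_zero fun k _ ↦ ?_
  generalize orthonormalBasisAt g x k = e
  obtain ⟨α, β, rfl⟩ := hspan e
  have h1 (e : TangentSpace I x) : g.inner x (curvatureAt nabla x u e u) (P x) = 0 := by
    rw [h.inner_curvatureAt_skew, h.curvatureAt_of_parallel hP hpar, map_zero, neg_zero]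
  have h2 (e : TangentSpace I x) : g.inner x (curvatureAt nabla x u e u) u = 0 := by
    have := h.inner_curvatureAt_skew u e u u
    rw [g.symm x u] at this
    exact self_eq_neg.1 this
  rw [map_add, map_smul, map_smul, h1, h2, smul_zero, smul_zero, add_zero]

/-- The quasi-Einstein condition along a fiber on which `f² = s` if `df = 0`, in terms of the Ricci
tensor of the fiber; `u` is the generator, normalized with respect to the metric of the fiber. -/
structure FiberRicciForm (g : SmoothMetric I M) (nabla : LinearConnection I M)
    (N a b : ℝ) {x : M} (P u : TangentSpace I x) (s : ℝ) : Prop where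
  pos : 0 < s
  unit : g.inner x u u = 1
  eq (v w : TangentSpace I x) : ricci g nabla x v w = N * s ^ 2 * (g.inner x v P * g.inner x w P)
    + a * s * g.inner x v w + b * s * (g.inner x v u * g.inner x w u)

/-- This is `Ric(·, P) = 0` divided by `s`. -/
theorem FiberRicciForm.inner_parallel {N a b s : ℝ} {x : M} {P : Π x : M, TangentSpace I x}
    {u : TangentSpace I x} (hR : FiberRicciForm g nabla N a b (P x) u s)
    (h : IsLeviCivita g nabla) (hP : CMDiff ∞ (T% P))
    (hpar : ∀ (x : M) (v : TangentSpace I x), nabla P x v = 0) (v : TangentSpace I x) :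
    (N * s * g.inner x (P x) (P x) + a) * g.inner x v (P x)
      + b * g.inner x u (P x) * g.inner x v u = 0 := by
  have h1 := hR.eq v (P x)
  rw [h.ricci_of_parallel hP hpar, g.symm x (P x) u] at h1
  refine mul_left_cancel₀ hR.pos.ne' ?_
  linear_combination -h1

/-- Here `κ₁ = 0` gives `a = -N s₁ ρ ≠ 0`, and `κ₂ ≠ 0` makes `u₂` orthogonal to everything
orthogonal to `P`. A nonzero `W` orthogonal to `P` and `u₁` then satisfies `Ric(W, W) = a sᵢ g(W,
W)` for both indices. -/
theorem FiberRicciForm.eq_of_inner_eq_zero {N a b s₁ s₂ : ℝ} (hN : 0 < N) (hb : b ≠ 0) {x : M}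
    {P : Π x : M, TangentSpace I x} {u₁ u₂ : TangentSpace I x}
    (hR₁ : FiberRicciForm g nabla N a b (P x) u₁ s₁)
    (hR₂ : FiberRicciForm g nabla N a b (P x) u₂ s₂)
    (h : IsLeviCivita g nabla) (hP : CMDiff ∞ (T% P))
    (hpar : ∀ (x : M) (v : TangentSpace I x), nabla P x v = 0) (hPx : P x ≠ 0)
    (hκ₁ : g.inner x u₁ (P x) = 0) (hκ₂ : g.inner x u₂ (P x) ≠ 0) : s₁ = s₂ := by
  have hρ := g.pos x (P x) hPx
  set ρ := g.inner x (P x) (P x) with hρdef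
  have h1 := hR₁.inner_parallel h hP hpar (P x)
  have h2 := hR₂.inner_parallel h hP hpar
  rw [hκ₁, ← hρdef, mul_zero, zero_mul, add_zero] at h1
  have ha : N * s₁ * ρ + a = 0 := (mul_eq_zero.1 h1).resolve_right hρ.ne'
  have ha0 : a ≠ 0 := by
    have := mul_pos (mul_pos hN hR₁.pos) hρ
    intro h0
    linarith
  have hab : N * s₂ * ρ + a = -b := by
    have := h2 u₂
    rw [hR₂.unit] at this
    refine mul_right_cancel₀ hκ₂ ?_
    linear_combination this
  have hu₂ (v : TangentSpace I x) (hv : g.inner x v (P x) = 0) : g.inner x v u₂ = 0 := by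
    have := h2 v
    rw [hv, mul_zero, zero_add] at this
    exact (mul_eq_zero.1 this).resolve_left (mul_ne_zero hb hκ₂)
  by_cases hW : ∃ W : TangentSpace I x, W ≠ 0 ∧ g.inner x W (P x) = 0 ∧ g.inner x W u₁ = 0
  · obtain ⟨W, hW0, hWP, hWu⟩ := hW
    have e1 := hR₁.eq W W
    have e2 := hR₂.eq W W
    rw [hWP, hWu] at e1
    rw [hWP, hu₂ W hWP] at e2
    have hWW := g.pos x W hW0
    refine mul_left_cancel₀ (mul_ne_zero ha0 hWW.ne') ?_
    linear_combination e2 - e1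
  -- Without such a `W`, the vectors `P` and `u₁` span, since the remainder of orthogonal projection
  -- onto them vanishes. Then `Ric(u₁, u₁) = 0`, whereas the second form gives `a s₂ ≠ 0`.
  · exfalso
    have hspan (v : TangentSpace I x) : ∃ α β : ℝ, v = α • P x + β • u₁ := by
      refine ⟨g.inner x v (P x) / ρ, g.inner x v u₁, ?_⟩
      by_contra hne
      refine hW ⟨v - (g.inner x v (P x) / ρ) • P x - g.inner x v u₁ • u₁, fun h0 ↦ hne ?_, ?_, ?_⟩
      · rw [sub_sub, sub_eq_zero] at h0
        exact h0
      · simp only [map_sub, map_smul, _root_.sub_apply, _root_.smul_apply, smul_eq_mul, hκ₁,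
          ← hρdef]
        field_simp
        ring
      · simp only [map_sub, map_smul, _root_.sub_apply, _root_.smul_apply, smul_eq_mul, hR₁.unit,
          g.symm x (P x) u₁, hκ₁]
        ring
    have e2 := hR₂.eq u₁ u₁
    rw [h.ricci_self_eq_zero hP hpar hspan, hκ₁, hu₂ u₁ hκ₁, hR₁.unit] at e2
    have := mul_ne_zero ha0 hR₂.pos.ne'
    apply this
    linear_combination -e2

theorem FiberRicciForm.eq_of_parallel {N a b s₁ s₂ : ℝ} (hN : 0 < N) (hb : b ≠ 0) {x : M}
    {P : Π x : M, TangentSpace I x} {u₁ u₂ : TangentSpace I x}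
    (hR₁ : FiberRicciForm g nabla N a b (P x) u₁ s₁)
    (hR₂ : FiberRicciForm g nabla N a b (P x) u₂ s₂)
    (h : IsLeviCivita g nabla) (hP : CMDiff ∞ (T% P))
    (hpar : ∀ (x : M) (v : TangentSpace I x), nabla P x v = 0) (hPx : P x ≠ 0) : s₁ = s₂ := by
  by_cases hκ₁ : g.inner x u₁ (P x) = 0 <;> by_cases hκ₂ : g.inner x u₂ (P x) = 0
  · have h1 := hR₁.inner_parallel h hP hpar (P x)
    have h2 := hR₂.inner_parallel h hP hpar (P x)
    have hρ := g.pos x (P x) hPx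
    rw [hκ₁] at h1
    rw [hκ₂] at h2
    refine mul_left_cancel₀ (mul_ne_zero hN.ne' (mul_ne_zero hρ.ne' hρ.ne')) ?_
    linear_combination h1 - h2
  · exact hR₁.eq_of_inner_eq_zero hN hb hR₂ h hP hpar hPx hκ₁ hκ₂
  · exact (hR₂.eq_of_inner_eq_zero hN hb hR₁ h hP hpar hPx hκ₂ hκ₁).symm
  -- Evaluating the relation at `u` itself and cancelling `κ` determines `s` by `N s ρ = -(a + b)`.
  · have key {s : ℝ} {u : TangentSpace I x} (hR : FiberRicciForm g nabla N a b (P x) u s)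
        (hκ : g.inner x u (P x) ≠ 0) : N * s * g.inner x (P x) (P x) = - (a + b) := by
      have := hR.inner_parallel h hP hpar u
      rw [hR.unit] at this
      refine mul_right_cancel₀ hκ ?_
      linear_combination this
    have hρ := g.pos x (P x) hPx
    refine mul_left_cancel₀ (mul_ne_zero hN.ne' hρ.ne') ?_
    linear_combination key hR₁ hκ₁ - key hR₂ hκ₂

end Pointwise

end Riemannian

/-! ### Warped products: lifts of vector fields and their brackets -/

noncomputable section WarpedProduct

open Set VectorField

set_option linter.unusedSectionVars false

variable {EB : Type*} [NormedAddCommGroup EB] [NormedSpace ℝ EB] [FiniteDimensional ℝ EB]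
  {HB : Type*} [TopologicalSpace HB] {IB : ModelWithCorners ℝ EB HB}
  {B : Type*} [TopologicalSpace B] [ChartedSpace HB B] [IsManifold IB ∞ B]
  {EF : Type*} [NormedAddCommGroup EF] [NormedSpace ℝ EF] [FiniteDimensional ℝ EF]
  {HF : Type*} [TopologicalSpace HF] {IF : ModelWithCorners ℝ EF HF}
  {F : Type*} [TopologicalSpace F] [ChartedSpace HF F] [IsManifold IF ∞ F]

/-- The inclusion of the tangent space of `B` at `z.1` into the tangent space of `B × F` at `z`. -/
def ofBase (z : B × F) : TangentSpace IB z.1 →L[ℝ] TangentSpace (IB.prod IF) z :=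
  ContinuousLinearMap.inl ℝ EB EF

/-- The vector field on `B × F` obtained by lifting a vector field on `B`. -/
def liftBase (X : Π p : B, TangentSpace IB p) (z : B × F) : TangentSpace (IB.prod IF) z :=
  ofBase z (X z.1)

section Lifts

variable (z : B × F)

@[simp] theorem toBase_ofBase (u : TangentSpace IB z.1) :
    toBase (IF := IF) z (ofBase z u) = u := rfl

@[simp] theorem toFiber_ofBase (u : TangentSpace IB z.1) :
    toFiber (IF := IF) z (ofBase z u) = 0 := rfl

@[simp] theorem toBase_ofFiber (v : TangentSpace IF z.2) :
    toBase (IB := IB) z (ofFiber z v) = 0 := rfl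

@[simp] theorem toFiber_ofFiber (v : TangentSpace IF z.2) :
    toFiber (IB := IB) z (ofFiber z v) = v := rfl

theorem tangent_prod_ext {u v : TangentSpace (IB.prod IF) z} (hB : toBase z u = toBase z v)
    (hF : toFiber z u = toFiber z v) : u = v :=
  Prod.ext hB hF

theorem contMDiff_liftFiber {V : Π q : F, TangentSpace IF q} (hV : CMDiff ∞ (T% V)) :
    CMDiff ∞ (T% (liftFiber (IB := IB) (B := B) V)) := by
  have h0 : CMDiff ∞ (T% (0 : Π p : B, TangentSpace IB p)) := Bundle.contMDiff_zeroSection ℝ _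
  exact (contMDiff_equivTangentBundleProd_symm (n := ∞)).comp
    ((h0.comp contMDiff_fst).prodMk (hV.comp contMDiff_snd))

theorem contMDiff_liftBase {X : Π p : B, TangentSpace IB p} (hX : CMDiff ∞ (T% X)) :
    CMDiff ∞ (T% (liftBase (IF := IF) (F := F) X)) := by
  have h0 : CMDiff ∞ (T% (0 : Π p : F, TangentSpace IF p)) := Bundle.contMDiff_zeroSection ℝ _
  exact (contMDiff_equivTangentBundleProd_symm (n := ∞)).comp
    ((hX.comp contMDiff_fst).prodMk (h0.comp contMDiff_snd))

theorem mvfderiv_comp_fst {φ : B → ℝ} (hφ : CMDiff ∞ φ) (v : TangentSpace (IB.prod IF) z) :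
    d% (fun z : B × F ↦ φ z.1) z v = d% φ z.1 (toBase z v) := by
  have := mvfderiv_comp_apply z ((hφ z.1).mdifferentiableAt (by simp))
    (mdifferentiableAt_fst (I := IB) (I' := IF)) v
  rw [← toBase_eq_mfderiv] at this
  exact this

theorem mvfderiv_comp_snd {φ : F → ℝ} (hφ : CMDiff ∞ φ) (v : TangentSpace (IB.prod IF) z) :
    d% (fun z : B × F ↦ φ z.2) z v = d% φ z.2 (toFiber z v) := by
  have := mvfderiv_comp_apply z ((hφ z.2).mdifferentiableAt (by simp))
    (mdifferentiableAt_snd (I := IB) (I' := IF)) v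
  rw [← toFiber_eq_mfderiv] at this
  exact this

theorem mvfderiv_mul_comp {φ : B → ℝ} {ψ : F → ℝ} (hφ : CMDiff ∞ φ) (hψ : CMDiff ∞ ψ)
    (v : TangentSpace (IB.prod IF) z) :
    d% (fun z : B × F ↦ φ z.1 * ψ z.2) z v
      = φ z.1 * d% ψ z.2 (toFiber z v) + ψ z.2 * d% φ z.1 (toBase z v) := by
  have h1 : CMDiff ∞ (fun z : B × F ↦ φ z.1) := hφ.comp contMDiff_fst
  have h2 : CMDiff ∞ (fun z : B × F ↦ ψ z.2) := hψ.comp contMDiff_snd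
  rw [mvfderiv_fun_mul_apply h1 h2, mvfderiv_comp_fst z hφ, mvfderiv_comp_snd z hψ]

theorem toBase_mlieBracket [T2Space B] {A A' : Π z : B × F, TangentSpace (IB.prod IF) z}
    {X X' : Π p : B, TangentSpace IB p} (hA : CMDiff ∞ (T% A)) (hA' : CMDiff ∞ (T% A'))
    (hX : CMDiff ∞ (T% X)) (hX' : CMDiff ∞ (T% X')) (h : ∀ z, toBase z (A z) = X z.1)
    (h' : ∀ z, toBase z (A' z) = X' z.1) :
    toBase z (mlieBracket (IB.prod IF) A A' z) = mlieBracket IB X X' z.1 := by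
  refine ext_mvfderiv fun φ hφ ↦ ?_
  have hφ' : CMDiff ∞ (fun z : B × F ↦ φ z.1) := hφ.comp contMDiff_fst
  rw [← mvfderiv_comp_fst z hφ, mvfderiv_mlieBracket hφ' hA hA', mvfderiv_mlieBracket hφ hX hX']
  simp only [mvfderiv_comp_fst _ hφ, h, h']
  rw [mvfderiv_comp_fst z (contMDiff_mvfderiv hφ hX'), mvfderiv_comp_fst z (contMDiff_mvfderiv hφ hX),
    h, h']

theorem toFiber_mlieBracket [T2Space F] {A A' : Π z : B × F, TangentSpace (IB.prod IF) z}
    {V V' : Π q : F, TangentSpace IF q} (hA : CMDiff ∞ (T% A)) (hA' : CMDiff ∞ (T% A'))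
    (hV : CMDiff ∞ (T% V)) (hV' : CMDiff ∞ (T% V')) (h : ∀ z, toFiber z (A z) = V z.2)
    (h' : ∀ z, toFiber z (A' z) = V' z.2) :
    toFiber z (mlieBracket (IB.prod IF) A A' z) = mlieBracket IF V V' z.2 := by
  refine ext_mvfderiv fun φ hφ ↦ ?_
  have hφ' : CMDiff ∞ (fun z : B × F ↦ φ z.2) := hφ.comp contMDiff_snd
  rw [← mvfderiv_comp_snd z hφ, mvfderiv_mlieBracket hφ' hA hA', mvfderiv_mlieBracket hφ hV hV']
  simp only [mvfderiv_comp_snd _ hφ, h, h']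
  rw [mvfderiv_comp_snd z (contMDiff_mvfderiv hφ hV'), mvfderiv_comp_snd z (contMDiff_mvfderiv hφ hV),
    h, h']

variable [T2Space B] [T2Space F] {X X' : Π p : B, TangentSpace IB p}
  {V V' : Π q : F, TangentSpace IF q}

theorem mlieBracket_liftFiber (hV : CMDiff ∞ (T% V)) (hV' : CMDiff ∞ (T% V')) :
    mlieBracket (IB.prod IF) (liftFiber V) (liftFiber V') z = ofFiber z (mlieBracket IF V V' z.2) := by
  have h0 : CMDiff ∞ (T% (0 : Π p : B, TangentSpace IB p)) := Bundle.contMDiff_zeroSection ℝ _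
  refine tangent_prod_ext z ?_ ?_
  · rw [toBase_mlieBracket z (contMDiff_liftFiber hV) (contMDiff_liftFiber hV') h0 h0
      (fun _ ↦ rfl) (fun _ ↦ rfl)]
    simp
  · exact toFiber_mlieBracket z (contMDiff_liftFiber hV) (contMDiff_liftFiber hV') hV hV'
      (fun _ ↦ rfl) (fun _ ↦ rfl)

theorem mlieBracket_liftBase (hX : CMDiff ∞ (T% X)) (hX' : CMDiff ∞ (T% X')) :
    mlieBracket (IB.prod IF) (liftBase X) (liftBase X') z = ofBase z (mlieBracket IB X X' z.1) := by
  have h0 : CMDiff ∞ (T% (0 : Π p : F, TangentSpace IF p)) := Bundle.contMDiff_zeroSection ℝ _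
  refine tangent_prod_ext z ?_ ?_
  · exact toBase_mlieBracket z (contMDiff_liftBase hX) (contMDiff_liftBase hX') hX hX'
      (fun _ ↦ rfl) (fun _ ↦ rfl)
  · rw [toFiber_mlieBracket z (contMDiff_liftBase hX) (contMDiff_liftBase hX') h0 h0
      (fun _ ↦ rfl) (fun _ ↦ rfl)]
    simp

theorem mlieBracket_liftFiber_liftBase (hV : CMDiff ∞ (T% V)) (hX : CMDiff ∞ (T% X)) :
    mlieBracket (IB.prod IF) (liftFiber V) (liftBase X) z = 0 := by
  have h0 : CMDiff ∞ (T% (0 : Π p : B, TangentSpace IB p)) := Bundle.contMDiff_zeroSection ℝ _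
  have h0' : CMDiff ∞ (T% (0 : Π p : F, TangentSpace IF p)) := Bundle.contMDiff_zeroSection ℝ _
  refine tangent_prod_ext z ?_ ?_
  · rw [toBase_mlieBracket z (contMDiff_liftFiber hV) (contMDiff_liftBase hX) h0 hX
      (fun _ ↦ rfl) (fun _ ↦ rfl)]
    simp
  · rw [toFiber_mlieBracket z (contMDiff_liftFiber hV) (contMDiff_liftBase hX) hV h0'
      (fun _ ↦ rfl) (fun _ ↦ rfl)]
    simp

theorem mlieBracket_liftBase_liftFiber (hX : CMDiff ∞ (T% X)) (hV : CMDiff ∞ (T% V)) :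
    mlieBracket (IB.prod IF) (liftBase X) (liftFiber V) z = 0 := by
  rw [mlieBracket_swap_apply, mlieBracket_liftFiber_liftBase z hV hX, neg_zero]

end Lifts

section Warped

variable {gB : SmoothMetric IB B} {gF : SmoothMetric IF F} {f : B → ℝ} {hf : CMDiff ∞ f}
  {f_pos : ∀ p, 0 < f p} (z : B × F)

theorem warpedMetric_inner (v w : TangentSpace (IB.prod IF) z) :
    (warpedMetric gB gF f hf f_pos).inner z v w = gB.inner z.1 (toBase z v) (toBase z w)
      + (f z.1) ^ 2 * gF.inner z.2 (toFiber z v) (toFiber z w) := rfl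

@[simp] theorem warpedMetric_inner_ofFiber (v : TangentSpace (IB.prod IF) z)
    (w : TangentSpace IF z.2) :
    (warpedMetric gB gF f hf f_pos).inner z v (ofFiber z w)
      = (f z.1) ^ 2 * gF.inner z.2 (toFiber z v) w := by
  simp [warpedMetric_inner]

@[simp] theorem warpedMetric_inner_ofBase (v : TangentSpace (IB.prod IF) z)
    (u : TangentSpace IB z.1) :
    (warpedMetric gB gF f hf f_pos).inner z v (ofBase z u) = gB.inner z.1 (toBase z v) u := by
  simp [warpedMetric_inner]

end Warped

variable [T2Space B] [T2Space F] {gB : SmoothMetric IB B} {gF : SmoothMetric IF F} {f : B → ℝ}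
  {hf : CMDiff ∞ f} {f_pos : ∀ p, 0 < f p}
  {nablaF : LinearConnection IF F} {nabla : LinearConnection (IB.prod IF) (B × F)}

/-! ### Levi-Civita connection of the warped product -/

section Koszul

theorem mvfderiv_sq {f : B → ℝ} (hf : CMDiff ∞ f) (p : B) (u : TangentSpace IB p) :
    d% (fun p ↦ f p ^ 2) p u = 2 * f p * d% f p u := by
  simp only [sq]
  rw [mvfderiv_fun_mul_apply hf hf]
  ring

theorem mvfderiv_warped {f : B → ℝ} (hf : CMDiff ∞ f) {V W : Π q : F, TangentSpace IF q}
    (hV : CMDiff ∞ (T% V)) (hW : CMDiff ∞ (T% W)) (z : B × F) (v : TangentSpace (IB.prod IF) z) :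
    d% (fun z : B × F ↦ f z.1 ^ 2 * gF.inner z.2 (V z.2) (W z.2)) z v
      = f z.1 ^ 2 * d% (fun q ↦ gF.inner q (V q) (W q)) z.2 (toFiber z v)
        + gF.inner z.2 (V z.2) (W z.2) * (2 * f z.1 * d% f z.1 (toBase z v)) := by
  rw [mvfderiv_mul_comp z (hf.pow 2) (gF.contMDiff_inner hV hW), mvfderiv_sq hf]

variable (hM : IsLeviCivita (warpedMetric gB gF f hf f_pos) nabla)
  (hF : IsLeviCivita gF nablaF) (z : B × F)
  {X X' : Π p : B, TangentSpace IB p} {V W W' : Π q : F, TangentSpace IF q}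
include hM

theorem toFiber_nabla_liftFiber (hF : IsLeviCivita gF nablaF) (hW : CMDiff ∞ (T% W))
    (v : TangentSpace IF z.2) :
    toFiber z (nabla (liftFiber W) z (ofFiber z v)) = nablaF W z.2 v := by
  refine gF.ext_inner fun w ↦ ?_
  obtain ⟨V, hV, rfl⟩ := exists_contMDiff_apply_eq v
  obtain ⟨W', hW', rfl⟩ := exists_contMDiff_apply_eq w
  have h1 := hM.koszul (contMDiff_liftFiber hV) (contMDiff_liftFiber hW) (contMDiff_liftFiber hW') z
  have h2 := hF.koszul hV hW hW' z.2
  rw [mlieBracket_liftFiber z hV hW, mlieBracket_liftFiber z hV hW',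
    mlieBracket_liftFiber z hW hW'] at h1
  simp only [liftFiber, warpedMetric_inner_ofFiber, toFiber_ofFiber] at h1
  rw [mvfderiv_warped hf hV hW, mvfderiv_warped hf hV hW', mvfderiv_warped hf hW hW'] at h1
  simp only [toFiber_ofFiber, toBase_ofFiber, map_zero, mul_zero, add_zero] at h1
  have hpos := pow_pos (f_pos z.1) 2
  refine mul_left_cancel₀ hpos.ne' ?_
  linear_combination (1 / 2) * h1 - (f z.1 ^ 2 / 2) * h2

/-- In the Koszul formula only the derivative of `f²` in the base direction survives; this is the
second fundamental form of the fiber. -/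
theorem inner_toBase_nabla_liftFiber (hW : CMDiff ∞ (T% W)) (v : TangentSpace IF z.2)
    (u : TangentSpace IB z.1) :
    gB.inner z.1 (toBase z (nabla (liftFiber W) z (ofFiber z v))) u
      = - (f z.1 * gF.inner z.2 v (W z.2) * d% f z.1 u) := by
  obtain ⟨V, hV, rfl⟩ := exists_contMDiff_apply_eq v
  obtain ⟨X, hX, rfl⟩ := exists_contMDiff_apply_eq u
  have h1 := hM.koszul (contMDiff_liftFiber hV) (contMDiff_liftFiber hW) (contMDiff_liftBase hX) z
  rw [mlieBracket_liftFiber z hV hW, mlieBracket_liftFiber_liftBase z hV hX,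
    mlieBracket_liftFiber_liftBase z hW hX] at h1
  simp only [liftFiber, liftBase, warpedMetric_inner_ofFiber, warpedMetric_inner_ofBase,
    toFiber_ofFiber, toBase_ofFiber, map_zero, _root_.zero_apply,
    mvfderiv_const] at h1
  rw [mvfderiv_warped hf hV hW] at h1
  simp only [toFiber_ofBase, toBase_ofBase, map_zero] at h1
  linear_combination (1 / 2) * h1

theorem nabla_liftFiber_ofBase (hV : CMDiff ∞ (T% V)) (u : TangentSpace IB z.1) :
    nabla (liftFiber V) z (ofBase z u) = ofFiber z ((d% f z.1 u / f z.1) • V z.2) := by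
  obtain ⟨X, hX, rfl⟩ := exists_contMDiff_apply_eq u
  have hne := (f_pos z.1).ne'
  refine (warpedMetric gB gF f hf f_pos).ext_inner fun w ↦ ?_
  have hw : w = ofBase z (toBase z w) + ofFiber z (toFiber z w) :=
    tangent_prod_ext z (by simp) (by simp)
  generalize toBase z w = wB at hw
  generalize toFiber z w = wF at hw
  obtain ⟨Y, hY, rfl⟩ := exists_contMDiff_apply_eq wB
  obtain ⟨W, hW, rfl⟩ := exists_contMDiff_apply_eq wF
  have h1 := hM.koszul (contMDiff_liftBase hX) (contMDiff_liftFiber hV) (contMDiff_liftBase hY) z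
  rw [mlieBracket_liftBase_liftFiber z hX hV, mlieBracket_liftBase z hX hY,
    mlieBracket_liftFiber_liftBase z hV hY] at h1
  have h2 := hM.koszul (contMDiff_liftBase hX) (contMDiff_liftFiber hV) (contMDiff_liftFiber hW) z
  rw [mlieBracket_liftBase_liftFiber z hX hV, mlieBracket_liftFiber z hV hW,
    mlieBracket_liftBase_liftFiber z hX hW] at h2
  simp only [liftFiber, liftBase, warpedMetric_inner_ofFiber, warpedMetric_inner_ofBase,
    toFiber_ofFiber, toBase_ofFiber, toBase_ofBase, toFiber_ofBase, map_zero, _root_.zero_apply,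
    mul_zero, mvfderiv_const] at h1 h2
  rw [mvfderiv_warped hf hV hW] at h2
  rw [mvfderiv_comp_fst z (gB.contMDiff_inner hX hY)] at h1
  simp only [toFiber_ofBase, toBase_ofBase, toBase_ofFiber, map_zero] at h1 h2
  rw [hw]
  simp only [map_add, warpedMetric_inner_ofFiber, warpedMetric_inner_ofBase, toFiber_ofFiber,
    toBase_ofFiber, map_smul, _root_.smul_apply, smul_eq_mul, map_zero, _root_.zero_apply]
  have hc : d% f z.1 (X z.1) = d% f z.1 (X z.1) / f z.1 * f z.1 := by field_simp
  linear_combination (1 / 2) * h1 + (1 / 2) * h2 + f z.1 * gF.inner z.2 (V z.2) (W z.2) * hc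

theorem nabla_liftBase_ofFiber (hX : CMDiff ∞ (T% X)) (v : TangentSpace IF z.2) :
    nabla (liftBase X) z (ofFiber z v) = ofFiber z ((d% f z.1 (X z.1) / f z.1) • v) := by
  obtain ⟨V, hV, rfl⟩ := exists_contMDiff_apply_eq v
  have h1 := hM.sub_eq_mlieBracket (contMDiff_liftFiber hV) (contMDiff_liftBase hX) z
  rw [mlieBracket_liftFiber_liftBase z hV hX, sub_eq_zero] at h1
  exact h1.trans (nabla_liftFiber_ofBase hM z hV (X z.1))

/-- Differentiate `g(X, V) = 0` in a base direction, along which the derivative of `V` is vertical: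
the leaves `B × {q}` are totally geodesic. -/
theorem toFiber_nabla_liftBase (hX : CMDiff ∞ (T% X)) (u : TangentSpace IB z.1) :
    toFiber z (nabla (liftBase X) z (ofBase z u)) = 0 := by
  refine gF.ext_inner fun w ↦ ?_
  obtain ⟨X', hX', rfl⟩ := exists_contMDiff_apply_eq u
  obtain ⟨V, hV, rfl⟩ := exists_contMDiff_apply_eq w
  have h1 := hM.mvfderiv_inner (contMDiff_liftBase hX) (contMDiff_liftFiber hV) z (ofBase z (X' z.1))
  rw [nabla_liftFiber_ofBase hM z hV] at h1
  simp only [liftFiber, liftBase, warpedMetric_inner_ofFiber, toFiber_ofBase, map_zero,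
    _root_.zero_apply, mul_zero, mvfderiv_const, add_zero] at h1
  have hpos := pow_pos (f_pos z.1) 2
  refine mul_left_cancel₀ hpos.ne' ?_
  simp only [map_zero, _root_.zero_apply, mul_zero]
  exact h1.symm

end Koszul

/-! ### Curvature of the warped product -/

section Curvature

variable (hM : IsLeviCivita (warpedMetric gB gF f hf f_pos) nabla)
  (hF : IsLeviCivita gF nablaF) (z : B × F)
  {X Y X' : Π p : B, TangentSpace IB p} {V W E E' : Π q : F, TangentSpace IF q}
include hM

theorem toBase_nabla_liftFiber {G : TangentSpace IB z.1} (hG : ∀ u, gB.inner z.1 G u = d% f z.1 u)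
    (hW : CMDiff ∞ (T% W)) (v : TangentSpace IF z.2) :
    toBase z (nabla (liftFiber W) z (ofFiber z v)) = - (f z.1 * gF.inner z.2 v (W z.2)) • G := by
  refine gB.ext_inner fun u ↦ ?_
  rw [inner_toBase_nabla_liftFiber hM z hW, map_smul, _root_.smul_apply, hG, smul_eq_mul, neg_mul]

include hF

theorem inner_nabla_nabla_liftFiber {G : TangentSpace IB z.1}
    (hG : ∀ u, gB.inner z.1 G u = d% f z.1 u) (hE : CMDiff ∞ (T% E)) (hW : CMDiff ∞ (T% W))
    (hE' : CMDiff ∞ (T% E')) :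
    f z.1 ^ 2 * gF.inner z.2 (toFiber z (nabla (fun y ↦ nabla (liftFiber W) y (liftFiber E y)) z
      (liftFiber V z))) (E' z.2) =
    f z.1 ^ 2 * gF.inner z.2 (nablaF (fun q ↦ nablaF W q (E q)) z.2 (V z.2)) (E' z.2)
      - f z.1 ^ 2 * gB.inner z.1 G G
        * (gF.inner z.2 (E z.2) (W z.2) * gF.inner z.2 (V z.2) (E' z.2)) := by
  have h1 := hM.inner_nabla_nabla (X := liftFiber V) (contMDiff_liftFiber hE)
    (contMDiff_liftFiber hW) (contMDiff_liftFiber hE') z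
  have h2 := hF.inner_nabla_nabla (X := V) hE hW hE' z.2
  have hfun : (fun y ↦ (warpedMetric gB gF f hf f_pos).inner y
      (nabla (liftFiber W) y (liftFiber E y)) (liftFiber E' y))
      = fun y ↦ f y.1 ^ 2 * gF.inner y.2 (nablaF W y.2 (E y.2)) (E' y.2) := by
    funext y
    simp only [liftFiber]
    rw [warpedMetric_inner_ofFiber]
    congr 3
    exact toFiber_nabla_liftFiber hM y hF hW _
  rw [hfun, mvfderiv_warped hf (hF.contMDiff_apply hE hW) hE', warpedMetric_inner] at h1
  have e1 : toBase z (nabla (liftFiber W) z (liftFiber E z)) = _ :=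
    toBase_nabla_liftFiber hM z hG hW (E z.2)
  have e2 : toFiber z (nabla (liftFiber W) z (liftFiber E z)) = _ :=
    toFiber_nabla_liftFiber hM z hF hW (E z.2)
  have e3 : toBase z (nabla (liftFiber E') z (liftFiber V z)) = _ :=
    toBase_nabla_liftFiber hM z hG hE' (V z.2)
  have e4 : toFiber z (nabla (liftFiber E') z (liftFiber V z)) = _ :=
    toFiber_nabla_liftFiber hM z hF hE' (V z.2)
  have e5 : toFiber (IB := IB) (IF := IF) z (liftFiber V z) = V z.2 := rfl
  have e6 : toBase (IB := IB) (IF := IF) z (liftFiber V z) = 0 := rfl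
  have e7 : liftFiber (IB := IB) (IF := IF) E' z = ofFiber z (E' z.2) := rfl
  rw [warpedMetric_inner, e1, e2, e3, e4, e5, e6, e7, toBase_ofFiber, toFiber_ofFiber] at h1
  simp only [map_zero, mul_zero, map_smul, _root_.smul_apply, smul_eq_mul] at h1
  linear_combination h1 - f z.1 ^ 2 * h2

/-- A Gauss equation: with `G = grad f`, the correction comes from the products of the base
components of `∇_E W` and `∇_V E'`. -/
theorem inner_curvature_liftFiber {G : TangentSpace IB z.1}
    (hG : ∀ u, gB.inner z.1 G u = d% f z.1 u) (hV : CMDiff ∞ (T% V)) (hE : CMDiff ∞ (T% E))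
    (hW : CMDiff ∞ (T% W)) (hE' : CMDiff ∞ (T% E')) :
    f z.1 ^ 2 * gF.inner z.2 (toFiber z (curvature nabla (liftFiber V) (liftFiber E) (liftFiber W) z))
      (E' z.2) =
    f z.1 ^ 2 * gF.inner z.2 (curvature nablaF V E W z.2) (E' z.2)
      - f z.1 ^ 2 * gB.inner z.1 G G
        * (gF.inner z.2 (E z.2) (W z.2) * gF.inner z.2 (V z.2) (E' z.2)
          - gF.inner z.2 (V z.2) (W z.2) * gF.inner z.2 (E z.2) (E' z.2)) := by
  unfold curvature
  rw [mlieBracket_liftFiber z hV hE]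
  simp only [map_sub, _root_.sub_apply]
  rw [toFiber_nabla_liftFiber hM z hF hW, mul_sub, mul_sub,
    inner_nabla_nabla_liftFiber hM hF z hG hE hW hE',
    inner_nabla_nabla_liftFiber hM hF z hG hV hW hE']
  ring

theorem toFiber_curvature_liftBase_liftFiber (hX : CMDiff ∞ (T% X)) (hE : CMDiff ∞ (T% E))
    (hV : CMDiff ∞ (T% V)) :
    toFiber z (curvature nabla (liftBase X) (liftFiber E) (liftFiber V) z) = 0 := by
  refine gF.ext_inner fun w ↦ ?_
  obtain ⟨E', hE', rfl⟩ := exists_contMDiff_apply_eq w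
  have hpos := pow_pos (f_pos z.1) 2
  refine mul_left_cancel₀ hpos.ne' ?_
  rw [← warpedMetric_inner_ofFiber (gB := gB) (hf := hf) (f_pos := f_pos)]
  unfold curvature
  rw [mlieBracket_liftBase_liftFiber z hX hE]
  simp only [map_sub, _root_.sub_apply, map_zero, _root_.zero_apply, mul_zero, sub_zero]
  have h1 := hM.inner_nabla_nabla (X := liftBase X) (contMDiff_liftFiber hE)
    (contMDiff_liftFiber hV) (contMDiff_liftFiber hE') z
  have h2 := hM.inner_nabla_nabla (X := liftFiber E) (contMDiff_liftBase hX)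
    (contMDiff_liftFiber hV) (contMDiff_liftFiber hE') z
  have hfun1 : (fun y ↦ (warpedMetric gB gF f hf f_pos).inner y
      (nabla (liftFiber V) y (liftFiber E y)) (liftFiber E' y))
      = fun y ↦ f y.1 ^ 2 * gF.inner y.2 (nablaF V y.2 (E y.2)) (E' y.2) := by
    funext y
    simp only [liftFiber]
    rw [warpedMetric_inner_ofFiber]
    congr 3
    exact toFiber_nabla_liftFiber hM y hF hV _
  have hfun2 : (fun y ↦ (warpedMetric gB gF f hf f_pos).inner y
      (nabla (liftFiber V) y (liftBase X y)) (liftFiber E' y))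
      = fun y ↦ (f y.1 * d% f y.1 (X y.1)) * gF.inner y.2 (V y.2) (E' y.2) := by
    funext y
    have hne := (f_pos y.1).ne'
    have e1 : nabla (liftFiber V) y (liftBase X y) = _ := nabla_liftFiber_ofBase hM y hV (X y.1)
    rw [e1]
    simp only [liftFiber]
    rw [warpedMetric_inner_ofFiber, toFiber_ofFiber, map_smul, _root_.smul_apply, smul_eq_mul]
    field_simp
  have e1 : nabla (liftFiber E') z (liftBase X z) = _ := nabla_liftFiber_ofBase hM z hE' (X z.1)
  have e2 : nabla (liftFiber V) z (liftBase X z) = _ := nabla_liftFiber_ofBase hM z hV (X z.1)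
  have e3 : toFiber z (nabla (liftFiber V) z (liftFiber E z)) = _ :=
    toFiber_nabla_liftFiber hM z hF hV (E z.2)
  have e4 : toFiber z (nabla (liftFiber E') z (liftFiber E z)) = _ :=
    toFiber_nabla_liftFiber hM z hF hE' (E z.2)
  rw [hfun1, mvfderiv_warped hf (hF.contMDiff_apply hE hV) hE', e1, warpedMetric_inner_ofFiber,
    e3] at h1
  have hφ : CMDiff ∞ (fun p ↦ f p * d% f p (X p)) := hf.mul (contMDiff_mvfderiv hf hX)
  rw [hfun2, mvfderiv_mul_comp z hφ (gF.contMDiff_inner hV hE'), e2,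
    (warpedMetric gB gF f hf f_pos).symm z (ofFiber z _), warpedMetric_inner_ofFiber, e4] at h2
  have e7 : liftFiber (IB := IB) (IF := IF) E' z = ofFiber z (E' z.2) := rfl
  have e8 : toFiber (IB := IB) (IF := IF) z (liftFiber E z) = E z.2 := rfl
  have e9 : toBase (IB := IB) (IF := IF) z (liftFiber E z) = 0 := rfl
  have e10 : toFiber (IB := IB) (IF := IF) z (liftBase X z) = 0 := rfl
  have e11 : toBase (IB := IB) (IF := IF) z (liftBase X z) = X z.1 := rfl
  rw [e7, e10, e11] at h1
  rw [e7, e8, e9, hF.mvfderiv_inner hV hE'] at h2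
  simp only [map_zero, mul_zero, map_smul, smul_eq_mul] at h1 h2
  have hs := gF.symm z.2 (V z.2) (nablaF E' z.2 (E z.2))
  have hc : d% f z.1 (X z.1) = d% f z.1 (X z.1) / f z.1 * f z.1 := by
    have hne := (f_pos z.1).ne'
    field_simp
  rw [h1, h2, hs]
  linear_combination f z.1 * (gF.inner z.2 (nablaF V z.2 (E z.2)) (E' z.2)
    - gF.inner z.2 (nablaF E' z.2 (E z.2)) (V z.2)) * hc

omit hF

theorem toBase_curvature_liftBase_liftBase (hX : CMDiff ∞ (T% X)) (hY : CMDiff ∞ (T% Y))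
    (hV : CMDiff ∞ (T% V)) :
    toBase z (curvature nabla (liftBase X) (liftBase Y) (liftFiber V) z) = 0 := by
  refine gB.ext_inner fun w ↦ ?_
  obtain ⟨X', hX', rfl⟩ := exists_contMDiff_apply_eq w
  rw [← warpedMetric_inner_ofBase (gF := gF) (hf := hf) (f_pos := f_pos)]
  unfold curvature
  rw [mlieBracket_liftBase z hX hY]
  simp only [map_sub, _root_.sub_apply, map_zero, _root_.zero_apply]
  have key {X Y : Π p : B, TangentSpace IB p} (hX : CMDiff ∞ (T% X)) (hY : CMDiff ∞ (T% Y)) :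
      (warpedMetric gB gF f hf f_pos).inner z (nabla (fun y ↦ nabla (liftFiber V) y (liftBase Y y)) z
        (liftBase X z)) (ofBase z (X' z.1)) = 0 := by
    have h1 := hM.inner_nabla_nabla (X := liftBase X) (contMDiff_liftBase hY)
      (contMDiff_liftFiber hV) (contMDiff_liftBase hX') z
    have hfun : (fun y ↦ (warpedMetric gB gF f hf f_pos).inner y
        (nabla (liftFiber V) y (liftBase Y y)) (liftBase X' y)) = fun y ↦ 0 := by
      funext y
      have e1 : nabla (liftFiber V) y (liftBase Y y) = _ := nabla_liftFiber_ofBase hM y hV (Y y.1)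
      rw [e1]
      simp [liftBase]
    have e1 : nabla (liftFiber V) z (liftBase Y z) = _ := nabla_liftFiber_ofBase hM z hV (Y z.1)
    have e2 : toFiber z (nabla (liftBase X') z (liftBase X z)) = 0 :=
      toFiber_nabla_liftBase hM z hX' (X z.1)
    rw [hfun, e1, (warpedMetric gB gF f hf f_pos).symm z (ofFiber z _), warpedMetric_inner_ofFiber,
      e2, mvfderiv_const] at h1
    exact h1.trans (by simp)
  rw [key hX hY, key hY hX, nabla_liftFiber_ofBase hM z hV]
  simp

theorem exists_inner_toBase_curvature_eq (hX : CMDiff ∞ (T% X)) (hX' : CMDiff ∞ (T% X')) :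
    ∃ c : ℝ, ((∀ p, d% f p = 0) → c = 0) ∧ ∀ V W : Π q : F, TangentSpace IF q, CMDiff ∞ (T% V) →
      CMDiff ∞ (T% W) →
      gB.inner z.1 (toBase z (curvature nabla (liftFiber V) (liftBase X) (liftFiber W) z)) (X' z.1)
        = c * gF.inner z.2 (V z.2) (W z.2) := by
  -- By the product rule this is `f (X X' f - (∇_X X') f)`, that is, `f` times the Hessian of `f`.
  -- Using the base component of the connection of `M` avoids introducing one on `B`.
  refine ⟨d% (fun p ↦ f p * d% f p (X' p)) z.1 (X z.1) - d% f z.1 (X z.1) * d% f z.1 (X' z.1)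
    - f z.1 * d% f z.1 (toBase z (nabla (liftBase X') z (liftBase X z))), fun h0 ↦ ?_,
    fun V W hV hW ↦ ?_⟩
  · simp only [h0, _root_.zero_apply, mul_zero, sub_zero]
    rw [mvfderiv_const]
    rfl
  rw [← warpedMetric_inner_ofBase (gF := gF) (hf := hf) (f_pos := f_pos)]
  unfold curvature
  rw [mlieBracket_liftFiber_liftBase z hV hX]
  simp only [map_sub, _root_.sub_apply, map_zero, sub_zero]
  have h1 := hM.inner_nabla_nabla (X := liftFiber V) (contMDiff_liftBase hX)
    (contMDiff_liftFiber hW) (contMDiff_liftBase hX') z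
  have h2 := hM.inner_nabla_nabla (X := liftBase X) (contMDiff_liftFiber hV)
    (contMDiff_liftFiber hW) (contMDiff_liftBase hX') z
  have hfun1 : (fun y ↦ (warpedMetric gB gF f hf f_pos).inner y
      (nabla (liftFiber W) y (liftBase X y)) (liftBase X' y)) = fun y ↦ 0 := by
    funext y
    have e1 : nabla (liftFiber W) y (liftBase X y) = _ := nabla_liftFiber_ofBase hM y hW (X y.1)
    rw [e1]
    simp [liftBase]
  have hfun2 : (fun y ↦ (warpedMetric gB gF f hf f_pos).inner y
      (nabla (liftFiber W) y (liftFiber V y)) (liftBase X' y))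
      = fun y ↦ (f y.1 * d% f y.1 (X' y.1)) * (- gF.inner y.2 (V y.2) (W y.2)) := by
    funext y
    have e1 := inner_toBase_nabla_liftFiber hM y hW (V y.2) (X' y.1)
    simp only [liftBase, liftFiber]
    rw [warpedMetric_inner_ofBase]
    refine e1.trans ?_
    ring
  have e1 : nabla (liftFiber W) z (liftBase X z) = _ := nabla_liftFiber_ofBase hM z hW (X z.1)
  have e2 : nabla (liftBase X') z (liftFiber V z) = _ := nabla_liftBase_ofFiber hM z hX' (V z.2)
  have e3 : toFiber z (nabla (liftBase X') z (liftBase X z)) = 0 :=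
    toFiber_nabla_liftBase hM z hX' (X z.1)
  have e4 : gB.inner z.1 (toBase z (nabla (liftFiber W) z (liftFiber V z))) _ = _ :=
    inner_toBase_nabla_liftFiber hM z hW (V z.2) (toBase z (nabla (liftBase X') z (liftBase X z)))
  have e10 : toFiber (IB := IB) (IF := IF) z (liftBase X z) = 0 := rfl
  have e11 : toBase (IB := IB) (IF := IF) z (liftBase X z) = X z.1 := rfl
  have e12 : liftBase (IB := IB) (IF := IF) X' z = ofBase z (X' z.1) := rfl
  rw [hfun1, e1, e2, warpedMetric_inner_ofFiber, toFiber_ofFiber, mvfderiv_const, e12] at h1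
  have hφ : CMDiff ∞ (fun p ↦ f p * d% f p (X' p)) := hf.mul (contMDiff_mvfderiv hf hX')
  have hψ : CMDiff ∞ (fun q ↦ - gF.inner q (V q) (W q)) := (gF.contMDiff_inner hV hW).neg
  rw [hfun2, mvfderiv_mul_comp z hφ hψ,
    warpedMetric_inner z (nabla (liftFiber W) z (liftFiber V z))
      (nabla (liftBase X') z (liftBase X z)), e3, e4, e10, e11, e12] at h2
  simp only [map_zero, mul_zero, map_smul, _root_.smul_apply, smul_eq_mul, _root_.zero_apply] at h1 h2
  have hs := gF.symm z.2 (W z.2) (V z.2)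
  rw [h1, h2]
  have hc : d% f z.1 (X z.1) = d% f z.1 (X z.1) / f z.1 * f z.1 := by
    have hne := (f_pos z.1).ne'
    field_simp
  have hc' : d% f z.1 (X' z.1) = d% f z.1 (X' z.1) / f z.1 * f z.1 := by
    have hne := (f_pos z.1).ne'
    field_simp
  rw [hs]
  linear_combination gF.inner z.2 (V z.2) (W z.2) * (d% f z.1 (X' z.1) * hc
    + d% f z.1 (X z.1) / f z.1 * f z.1 * hc')

end Curvature

/-! ### Ricci tensor of the warped product -/

section Ricci

theorem ricci_warpedMetric_eq_sum (hM : IsLeviCivita (warpedMetric gB gF f hf f_pos) nabla)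
    (z : B × F) (v w : TangentSpace (IB.prod IF) z) :
    ricci (warpedMetric gB gF f hf f_pos) nabla z v w =
      (∑ i, gB.inner z.1 (toBase z (curvatureAt nabla z v
        (ofBase z (orthonormalBasisAt gB z.1 i)) w)) (orthonormalBasisAt gB z.1 i))
      + ∑ j, gF.inner z.2 (toFiber z (curvatureAt nabla z v
        (ofFiber z (orthonormalBasisAt gF z.2 j)) w)) (orthonormalBasisAt gF z.2 j) := by
  have hne := (f_pos z.1).ne'
  let bB := orthonormalBasisAt gB z.1
  let bF := orthonormalBasisAt gF z.2
  -- Fiber vectors are rescaled by `1 / f` to become unit for the warped metric. In the trace the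
  -- two factors `1 / f` cancel the `f²` of the metric.
  let bF' := bF.unitsSMul fun _ ↦ Units.mk0 (f z.1)⁻¹ (inv_ne_zero hne)
  let β : Module.Basis (Fin (Module.finrank ℝ EB) ⊕ Fin (Module.finrank ℝ EF)) ℝ
      (TangentSpace (IB.prod IF) z) :=
    bB.prod bF'
  have hl (i) : β (.inl i) = ofBase z (bB i) :=
    Prod.ext (Module.Basis.prod_apply_inl_fst bB bF' i) (Module.Basis.prod_apply_inl_snd bB bF' i)
  have hr (j) : β (.inr j) = (f z.1)⁻¹ • ofFiber z (bF j) := by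
    refine tangent_prod_ext z ?_ ?_
    · rw [map_smul, toBase_ofFiber, smul_zero]
      exact Module.Basis.prod_apply_inr_fst bB bF' j
    · rw [map_smul, toFiber_ofFiber]
      refine (Module.Basis.prod_apply_inr_snd bB bF' j).trans ?_
      exact Module.Basis.unitsSMul_apply j
  have hB := orthonormalBasisAt_inner gB z.1
  have hF := orthonormalBasisAt_inner gF z.2
  have hβ (i j) : (warpedMetric gB gF f hf f_pos).inner z (β i) (β j) = if i = j then 1 else 0 := by
    rcases i with i | i <;> rcases j with j | j
    · simp [hl, bB, hB]
    · simp [hl, hr]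
    · simp [hl, hr]
    · simp only [hr, map_smul, _root_.smul_apply, warpedMetric_inner_ofFiber, toFiber_ofFiber, bF, hF,
        smul_eq_mul, Sum.inr.injEq]
      split_ifs
      · field_simp
      · simp
  rw [hM.ricci_eq_sum β hβ, Fintype.sum_sum_type]
  congr 1
  · refine Finset.sum_congr rfl fun i _ ↦ ?_
    rw [hl, warpedMetric_inner_ofBase]
  · refine Finset.sum_congr rfl fun j _ ↦ ?_
    have h1 := (hM.ricciMap z v w).map_smul (f z.1)⁻¹ (ofFiber z (bF j))
    rw [hM.ricciMap_apply, hM.ricciMap_apply] at h1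
    rw [hr, h1]
    simp only [map_smul, _root_.smul_apply, warpedMetric_inner_ofFiber, smul_eq_mul, bF]
    field_simp

theorem ricci_ofBase_ofFiber (hM : IsLeviCivita (warpedMetric gB gF f hf f_pos) nabla)
    (hF : IsLeviCivita gF nablaF) (z : B × F) (u : TangentSpace IB z.1) (v : TangentSpace IF z.2) :
    ricci (warpedMetric gB gF f hf f_pos) nabla z (ofBase z u) (ofFiber z v) = 0 := by
  obtain ⟨X, hX, rfl⟩ := exists_contMDiff_apply_eq u
  obtain ⟨V, hV, rfl⟩ := exists_contMDiff_apply_eq v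
  rw [ricci_warpedMetric_eq_sum hM, Finset.sum_eq_zero, Finset.sum_eq_zero, add_zero]
  · intro j _
    obtain ⟨E, hE, h⟩ := exists_contMDiff_apply_eq (orthonormalBasisAt gF z.2 j)
    have h1 := hM.curvatureAt_eq (contMDiff_liftBase hX) (contMDiff_liftFiber hE)
      (contMDiff_liftFiber hV) z
    simp only [liftBase, liftFiber] at h1
    rw [← h, h1]
    have h2 := toFiber_curvature_liftBase_liftFiber hM hF z hX hE hV
    rw [h2]
    simp
  · intro i _
    obtain ⟨Y, hY, h⟩ := exists_contMDiff_apply_eq (orthonormalBasisAt gB z.1 i)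
    have h1 := hM.curvatureAt_eq (contMDiff_liftBase hX) (contMDiff_liftBase hY)
      (contMDiff_liftFiber hV) z
    have h2 := toBase_curvature_liftBase_liftBase hM z hX hY hV
    simp only [liftBase, liftFiber] at h1
    rw [← h, h1, h2]
    simp

theorem exists_ricci_ofFiber_eq (hM : IsLeviCivita (warpedMetric gB gF f hf f_pos) nabla)
    (hF : IsLeviCivita gF nablaF) (z : B × F) :
    ∃ h : ℝ, ((∀ p, d% f p = 0) → h = 0) ∧ ∀ v w : TangentSpace IF z.2,
      ricci (warpedMetric gB gF f hf f_pos) nabla z (ofFiber z v) (ofFiber z w)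
        = ricci gF nablaF z.2 v w + h * gF.inner z.2 v w := by
  choose X hX hXz using fun i ↦ exists_contMDiff_apply_eq (orthonormalBasisAt gB z.1 i)
  choose E hE hEz using fun j ↦ exists_contMDiff_apply_eq (orthonormalBasisAt gF z.2 j)
  choose c hc0 hc using fun i ↦ exists_inner_toBase_curvature_eq hM z (hX i) (hX i)
  obtain ⟨G, hG⟩ := gB.exists_inner_eq z.1 (d% f z.1)
  have hpos := pow_pos (f_pos z.1) 2
  -- This is `f Δf + (n₂ - 1) |grad f|²`, where `Δ` is the trace of the Hessian: base directions
  -- contribute the first term, fiber directions the second.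
  refine ⟨∑ i, c i + gB.inner z.1 G G * (Module.finrank ℝ EF - 1), fun h0 ↦ ?_, fun v w ↦ ?_⟩
  · rw [Finset.sum_eq_zero fun i _ ↦ hc0 i h0, hG, h0]
    simp
  obtain ⟨V, hV, rfl⟩ := exists_contMDiff_apply_eq v
  obtain ⟨W, hW, rfl⟩ := exists_contMDiff_apply_eq w
  have hb (i) : gB.inner z.1 (toBase z (curvatureAt nabla z (ofFiber z (V z.2))
      (ofBase z (orthonormalBasisAt gB z.1 i)) (ofFiber z (W z.2)))) (orthonormalBasisAt gB z.1 i)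
      = c i * gF.inner z.2 (V z.2) (W z.2) := by
    have h1 := hM.curvatureAt_eq (contMDiff_liftFiber hV) (contMDiff_liftBase (hX i))
      (contMDiff_liftFiber hW) z
    have h2 := hc i V W hV hW
    rw [← h1] at h2
    simp only [liftBase, liftFiber] at h2
    rw [← hXz, h2]
  have hf (j) : gF.inner z.2 (toFiber z (curvatureAt nabla z (ofFiber z (V z.2))
      (ofFiber z (orthonormalBasisAt gF z.2 j)) (ofFiber z (W z.2)))) (orthonormalBasisAt gF z.2 j)
      = gF.inner z.2 (curvatureAt nablaF z.2 (V z.2) (orthonormalBasisAt gF z.2 j) (W z.2))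
          (orthonormalBasisAt gF z.2 j)
        - gB.inner z.1 G G * (gF.inner z.2 (V z.2) (orthonormalBasisAt gF z.2 j)
          * gF.inner z.2 (W z.2) (orthonormalBasisAt gF z.2 j) - gF.inner z.2 (V z.2) (W z.2)) := by
    have h1 := hM.curvatureAt_eq (contMDiff_liftFiber hV) (contMDiff_liftFiber (hE j))
      (contMDiff_liftFiber hW) z
    have h2 := inner_curvature_liftFiber hM hF z hG hV (hE j) hW (hE j)
    have h3 := orthonormalBasisAt_inner gF z.2 j j
    rw [← h1, ← hF.curvatureAt_eq hV (hE j) hW] at h2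
    simp only [liftFiber, hEz, h3, if_true] at h2
    refine mul_left_cancel₀ hpos.ne' (h2.trans ?_)
    rw [gF.symm z.2 _ (W z.2)]
    ring
  rw [ricci_warpedMetric_eq_sum hM]
  simp only [hb, hf, Finset.sum_sub_distrib, ← Finset.mul_sum, ← Finset.sum_mul]
  rw [gF.sum_inner_mul_inner]
  simp only [Finset.sum_const, Finset.card_univ, Fintype.card_fin, nsmul_eq_mul]
  unfold ricci
  ring

end Ricci

/-! ### The quasi-Einstein equation in mixed and vertical directions -/

section QuasiEinstein

variable {P : Π q : F, TangentSpace IF q} {U : Π z : B × F, TangentSpace (IB.prod IF) z} {a b : ℝ}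

/-- The equation is evaluated on a base vector and `P`. Its right side vanishes as `U` is vertical,
and `Ric` has no mixed part, so only `g(P, ∇_X P) = (Xf / f) g(P, P)` remains. -/
theorem mvfderiv_eq_zero_of_parallel_ne_zero (hdim : 2 ≤ Module.finrank ℝ (EB × EF))
    (hM : IsLeviCivita (warpedMetric gB gF f hf f_pos) nabla)
    (hF : IsLeviCivita gF nablaF) (hP : CMDiff ∞ (T% P)) (hU : ∀ z, toBase z (U z) = 0)
    (hQE : IsQuasiEinstein (warpedMetric gB gF f hf f_pos)
      (semiSymmetricConnection (warpedMetric gB gF f hf f_pos) nabla (liftFiber P)) a b U)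
    {z : B × F} (hPz : P z.2 ≠ 0) : d% f z.1 = 0 := by
  ext u
  have h1 := hQE.ricci_eq z (ofBase z u) (ofFiber z (P z.2))
  rw [ricci_semiSymmetricConnection hM (contMDiff_liftFiber hP), ricci_ofBase_ofFiber hM hF,
    nabla_liftFiber_ofBase hM z hP u] at h1
  simp only [warpedMetric_inner, toBase_ofBase, toFiber_ofBase, toBase_ofFiber, toFiber_ofFiber, hU,
    liftFiber, map_zero, _root_.zero_apply, map_smul, smul_eq_mul, mul_zero, zero_mul, add_zero,
    zero_add, sub_zero] at h1
  have hρ := gF.pos z.2 (P z.2) hPz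
  have hp := f_pos z.1
  have hp' := hp.ne'
  have hN : (0 : ℝ) < (Module.finrank ℝ (EB × EF) : ℝ) - 1 := by
    have : (2 : ℝ) ≤ Module.finrank ℝ (EB × EF) := by exact_mod_cast hdim
    linarith
  have h2 : ((Module.finrank ℝ (EB × EF) : ℝ) - 1) * (f z.1 * gF.inner z.2 (P z.2) (P z.2))
      * d% f z.1 u = 0 := by
    rw [← h1]
    field_simp
  exact (mul_eq_zero.1 h2).resolve_left (mul_pos hN (mul_pos hp hρ)).ne'

theorem exists_ricci_fiber_eq (hM : IsLeviCivita (warpedMetric gB gF f hf f_pos) nabla)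
    (hF : IsLeviCivita gF nablaF) (hP : CMDiff ∞ (T% P))
    (hpar : ∀ (q : F) (v : TangentSpace IF q), nablaF P q v = 0) (hU : ∀ z, toBase z (U z) = 0)
    (hQE : IsQuasiEinstein (warpedMetric gB gF f hf f_pos)
      (semiSymmetricConnection (warpedMetric gB gF f hf f_pos) nabla (liftFiber P)) a b U)
    (z : B × F) : ∃ (h : ℝ) (u : TangentSpace IF z.2), ((∀ p, d% f p = 0) → h = 0) ∧
      gF.inner z.2 u u = 1 ∧ ∀ v w : TangentSpace IF z.2,
        ricci gF nablaF z.2 v w + h * gF.inner z.2 v w =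
          ((Module.finrank ℝ (EB × EF) : ℝ) - 1) * (f z.1 ^ 2) ^ 2
              * (gF.inner z.2 v (P z.2) * gF.inner z.2 w (P z.2))
            + a * f z.1 ^ 2 * gF.inner z.2 v w
            + b * f z.1 ^ 2 * (gF.inner z.2 v u * gF.inner z.2 w u) := by
  obtain ⟨h, h0, hh⟩ := exists_ricci_ofFiber_eq hM hF z
  -- Since `U` is vertical and `g`-unit, `f U` is unit for `g_F`. Of the factor `f⁴` in `g(v, U)
  -- g(w, U)`, this absorbs `f²`.
  refine ⟨h, f z.1 • toFiber z (U z), h0, ?_, fun v w ↦ ?_⟩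
  · have h1 := hQE.unit z
    rw [warpedMetric_inner, hU] at h1
    simp only [map_zero, zero_add] at h1
    simp only [map_smul, _root_.smul_apply, smul_eq_mul]
    linear_combination h1
  · have h1 := hQE.ricci_eq z (ofFiber z v) (ofFiber z w)
    have h2 : toFiber z (nabla (liftFiber P) z (ofFiber z v)) = 0 :=
      (toFiber_nabla_liftFiber hM z hF hP v).trans (hpar z.2 v)
    rw [ricci_semiSymmetricConnection hM (contMDiff_liftFiber hP), hh v w] at h1
    simp only [warpedMetric_inner, toBase_ofFiber, toFiber_ofFiber, h2, liftFiber, map_zero,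
      _root_.zero_apply, mul_zero, add_zero, zero_add] at h1
    simp only [map_smul, smul_eq_mul]
    linear_combination h1

end QuasiEinstein

end WarpedProduct

/-! ### Conclusion: comparison of two base points over one point of the fiber -/

theorem theorem3p14
    {EB : Type*} [NormedAddCommGroup EB] [NormedSpace ℝ EB] [FiniteDimensional ℝ EB]
    {B : Type*} [TopologicalSpace B] [T2Space B] [ChartedSpace EB B] [IsManifold 𝓘(ℝ, EB) ∞ B]
    {EF : Type*} [NormedAddCommGroup EF] [NormedSpace ℝ EF] [FiniteDimensional ℝ EF]
    {F : Type*} [TopologicalSpace F] [T2Space F] [Nonempty F] [ChartedSpace EF F]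
    [IsManifold 𝓘(ℝ, EF) ∞ F]
    (dim_B : 2 ≤ Module.finrank ℝ EB) (dim_F : 2 ≤ Module.finrank ℝ EF)
    (gB : SmoothMetric 𝓘(ℝ, EB) B) (gF : SmoothMetric 𝓘(ℝ, EF) F)
    (f : B → ℝ) (f_smooth : CMDiff ∞ f) (f_pos : ∀ p, 0 < f p)
    (nablaF : LinearConnection 𝓘(ℝ, EF) F) (hF : IsLeviCivita gF nablaF)
    (nabla : LinearConnection (𝓘(ℝ, EB).prod 𝓘(ℝ, EF)) (B × F))
    (hM : IsLeviCivita (warpedMetric gB gF f f_smooth f_pos) nabla)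
    (P : Π q : F, TangentSpace 𝓘(ℝ, EF) q) (P_smooth : CMDiff ∞ (T% P))
    (P_parallel : ∀ (q : F) (v : TangentSpace 𝓘(ℝ, EF) q), nablaF P q v = 0)
    (U : Π z : B × F, TangentSpace (𝓘(ℝ, EB).prod 𝓘(ℝ, EF)) z)
    (U_vertical : ∀ z, toBase z (U z) = 0)
    (a b : ℝ) (hb : b ≠ 0)
    (hQE : IsQuasiEinstein (warpedMetric gB gF f f_smooth f_pos)
      (semiSymmetricConnection (warpedMetric gB gF f f_smooth f_pos) nabla (liftFiber P)) a b U) :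
    ∃ c : ℝ, ∀ p, f p = c := by
  rcases isEmpty_or_nonempty B with hB | ⟨⟨p₀⟩⟩
  · exact ⟨0, fun p ↦ hB.elim p⟩
  obtain ⟨q⟩ := ‹Nonempty F›
  have hdim : 2 ≤ Module.finrank ℝ (EB × EF) := by
    rw [Module.finrank_prod]
    lia
  have hN : (0 : ℝ) < (Module.finrank ℝ (EB × EF) : ℝ) - 1 := by
    have : (2 : ℝ) ≤ Module.finrank ℝ (EB × EF) := by exact_mod_cast hdim
    linarith
  choose h u h0 hu hR using fun p ↦
    exists_ricci_fiber_eq hM hF P_smooth P_parallel U_vertical hQE (p, q)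
  have hs (p : B) : 0 < f p ^ 2 := pow_pos (f_pos p) 2
  refine ⟨f p₀, fun p ↦ (sq_eq_sq₀ (f_pos p).le (f_pos p₀).le).1 ?_⟩
  -- If `P` vanishes at `q`, the unknown `h p` only shifts the coefficient of `g_F`, so no
  -- information on `df` is needed. Otherwise `df = 0` removes `h`.
  by_cases hPq : P q = 0
  · refine gF.eq_of_forall_inner_eq dim_F (hu p) (hu p₀) hb (hs p) (hs p₀)
      (k₁ := a * f p ^ 2 - h p) (k₂ := a * f p₀ ^ 2 - h p₀) fun v ↦ ?_
    have h1 := hR p v v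
    have h2 := hR p₀ v v
    rw [hPq, map_zero] at h1 h2
    linear_combination h2 - h1
  · have hdf (p : B) : d% f p = 0 :=
      mvfderiv_eq_zero_of_parallel_ne_zero hdim hM hF P_smooth U_vertical hQE (z := (p, q)) hPq
    have hform (p : B) : FiberRicciForm gF nablaF ((Module.finrank ℝ (EB × EF) : ℝ) - 1) a b (P q)
        (u p) (f p ^ 2) := by
      refine ⟨hs p, hu p, fun v w ↦ ?_⟩
      rw [← hR p v w, h0 p hdf, zero_mul, add_zero]
    exact (hform p).eq_of_parallel hN hb (hform p₀) hF P_smooth P_parallel hPq
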